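/- Let $K$ be a field and let $H \subsetneq \mathbb{N}_0$ be a numerical semigroup, i.e. a submonoid of $\mathbb{N}_0=\{0,1,2,\dots\}$ with finite complement, with $H \neq \mathbb{N}_0$. Suppose that $H$ is minimally generated by $a_1 < \dots < a_v$ and has minimal multiplicity, i.e. $v = a_1$. Let $R = K[[H]]$ be the ring of all formal power series over $K$ in one variable $t$ whose exponents all lie in $H$. Then $R$ is a far-flung Gorenstein ring if and only if $$\{2a_v - a_1 + 1, \dots, 2a_v\} \subseteq \{a_i + a_j : 2 \le i, j \le v\}.$$ Here a one-dimensional Noetherian Cohen--Macaulay local ring $R$ with total ring of fractions $\mathrm{Q}(R)$ and integral closure $\overline{R}\subseteq \mathrm{Q}(R)$, such that $\overline{R}$ is a finitely generated $R$-module and some $R$-module $C$ with $R \subseteq C \subseteq \overline{R}$ is isomorphic to the canonical module $\omega_R$, is called far-flung Gorenstein if $\mathrm{tr}_R(\omega_R) = R : \overline{R}$, where $\mathrm{tr}_R(\omega_R) = \sum_{f \in \mathrm{Hom}_R(\omega_R, R)} \mathrm{Im}\, f$ and $R : \overline{R} = \{\alpha \in \mathrm{Q}(R) : \alpha \overline{R}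 \subseteq R\}$. -/

import Mathlib

/-- A numerical semigroup: a submonoid of the natural numbers with finite complement. -/
def IsNumericalSemigroup (H : AddSubmonoid ℕ) : Prop :=
  ((H : Set ℕ)ᶜ).Finite

/-- The numerical semigroup ring `K[[H]]`: the subring of the formal power series ring `K[[t]]`
formed by the power series all of whose exponents lie in `H`. -/
def semigroupRing (K : Type*) [Field K] (H : AddSubmonoid ℕ) : Subalgebra K (PowerSeries K) where
  carrier := {f | ∀ n, PowerSeries.coeff n f ≠ 0 → n ∈ H}
  mul_mem' := by
    intro f g hf hg n hn
    rw [PowerSeries.coeff_mul] at hn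
    obtain ⟨p, hp, hne⟩ := Finset.exists_ne_zero_of_sum_ne_zero hn
    rw [← Finset.HasAntidiagonal.mem_antidiagonal.mp hp]
    exact H.add_mem (hf _ (left_ne_zero_of_mul hne)) (hg _ (right_ne_zero_of_mul hne))
  add_mem' := by
    intro f g hf hg n hn
    by_cases h : PowerSeries.coeff n f = 0
    · exact hg n fun h' => hn (by rw [map_add, h, h', add_zero])
    · exact hf n h
  algebraMap_mem' := by
    intro r n hn
    rw [PowerSeries.algebraMap_apply, Algebra.algebraMap_self, RingHom.id_apply,
      PowerSeries.coeff_C] at hn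
    by_cases h : n = 0
    · exact h ▸ H.zero_mem
    · exact absurd (if_neg h) hn

/-- The inverse of a power series of `K[[H]]` with nonzero constant coefficient is in `K[[H]]`. -/
theorem inv_mem_semigroupRing {K : Type*} [Field K] {H : AddSubmonoid ℕ} {f : PowerSeries K}
    (hf : f ∈ semigroupRing K H) : f⁻¹ ∈ semigroupRing K H := by
  intro n
  induction n using Nat.strong_induction_on with
  | _ n ih =>
    intro hn
    rw [PowerSeries.coeff_inv] at hn
    split_ifs at hn with h
    · exact h ▸ H.zero_mem
    · obtain ⟨p, hp, hne⟩ := Finset.exists_ne_zero_of_sum_ne_zero (right_ne_zero_of_mul hn)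
      split_ifs at hne with hlt
      · rw [← Finset.HasAntidiagonal.mem_antidiagonal.mp hp]
        exact H.add_mem (hf _ (left_ne_zero_of_mul hne)) (ih _ hlt (right_ne_zero_of_mul hne))
      · exact absurd rfl hne

/-- `K[[H]]` is a local ring. -/
instance semigroupRing_isLocalRing (K : Type*) [Field K] (H : AddSubmonoid ℕ) :
    IsLocalRing (semigroupRing K H) := by
  let φ : semigroupRing K H →+* K :=
    (PowerSeries.constantCoeff (R := K)).comp (semigroupRing K H).val.toRingHom
  have hφ : IsLocalHom φ := by
    refine ⟨fun f hf => ?_⟩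
    have h0 : PowerSeries.constantCoeff (f : PowerSeries K) ≠ 0 := hf.ne_zero
    refine IsUnit.of_mul_eq_one ⟨(f : PowerSeries K)⁻¹, inv_mem_semigroupRing f.2⟩ ?_
    exact Subtype.ext (PowerSeries.mul_inv_cancel _ h0)
  exact φ.domain_isLocalRing

/-- The trace ideal `tr_R(M)`, the sum of the images of all `R`-linear maps `M → R`. -/
def traceIdeal (R : Type*) [CommRing R] (M : Type*) [AddCommGroup M] [Module R M] : Ideal R :=
  ⨆ f : M →ₗ[R] R, LinearMap.range f

universe u

open CategoryTheory in
/-- `M` is a canonical module of the Cohen-Macaulay local ring `R` of dimension `d` with residue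
field `k`: `M` is finitely generated, `Ext^d_R(k, M) ≅ k`, and `Ext^i_R(k, M) = 0` for `i ≠ d`.
That is, `M` is a maximal Cohen-Macaulay module of type one and of finite injective dimension. -/
structure IsCanonicalModule (R : Type u) [CommRing R] [IsLocalRing R]
    (M : Type u) [AddCommGroup M] [Module R M] : Prop where
  finite : Module.Finite R M
  ext_dim : ∀ i : ℕ, (i : WithBot ℕ∞) = ringKrullDim R →
    Nonempty (Abelian.Ext (ModuleCat.of R (IsLocalRing.ResidueField R)) (ModuleCat.of R M) i
      ≃ₗ[R] IsLocalRing.ResidueField R)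
  ext_ne_dim : ∀ i : ℕ, (i : WithBot ℕ∞) ≠ ringKrullDim R →
    Subsingleton
      (Abelian.Ext (ModuleCat.of R (IsLocalRing.ResidueField R)) (ModuleCat.of R M) i)

/-- The integral closure of `R` in its total ring of fractions `Q(R)`, as an `R`-submodule
of `Q(R)`. -/
noncomputable def integralClosureQ (R : Type u) [CommRing R] : Submodule R (FractionRing R) :=
  Subalgebra.toSubmodule (integralClosure R (FractionRing R))

/-- A far-flung Gorenstein ring: a Noetherian Cohen-Macaulay local ring `R` of dimension one, with
finitely generated integral closure `R'` in the total ring of fractions `Q(R)` and with a canonical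
module `C` such that `R ⊆ C ⊆ R' ⊆ Q(R)`, whose canonical trace ideal is `tr_R(C) = R : R'`.
The colon `R : R' = {α ∈ Q(R) | α R' ⊆ R}` is the quotient `1 / R'` of submodules of `Q(R)`, and
`tr_R(C)` is viewed inside `Q(R)`. All canonical modules are isomorphic, so `tr_R(C)` does not
depend on the choice of `C`. -/
structure IsFarFlungGorenstein (R : Type u) [CommRing R] [IsLocalRing R] : Prop where
  noetherian : IsNoetherianRing R
  dim_one : ringKrullDim R = 1
  cohenMacaulay : ∃ x ∈ IsLocalRing.maximalIdeal R, x ∈ nonZeroDivisors R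
  finite_integralClosure : Module.Finite R (integralClosureQ R)
  trace_canonical : ∃ C : Submodule R (FractionRing R),
    1 ≤ C ∧ C ≤ integralClosureQ R ∧ IsCanonicalModule R C ∧
    Submodule.map (Algebra.linearMap R (FractionRing R)) (traceIdeal R C) =
      (1 : Submodule R (FractionRing R)) / integralClosureQ R

/-- `H` is minimally generated by `a 1 < a 2 < ⋯ < a v`. -/
structure IsMinimallyGeneratedBy (H : AddSubmonoid ℕ) (v : ℕ) (a : ℕ → ℕ) : Prop where
  strictMono : StrictMonoOn a (Set.Icc 1 v)
  closure_eq : AddSubmonoid.closure (a '' Set.Icc 1 v) = H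
  minimal : ∀ s ⊂ a '' Set.Icc 1 v, AddSubmonoid.closure s ≠ H

/-! Let `F` be the Frobenius number and Ω = {n : F - n ∉ H}. The series with exponents in Ω form a
canonical module C with R ⊆ C ⊆ K[[t]], its trace is C(R : C), and R : K[[t]] = t^(F+1)K[[t]]. The
conductor always lies in the trace. The two are equal exactly when Ω + Ω = ℕ: if n is not such a sum
then F - n + Ω ⊆ H, so t^(F-n) lies in R : C but not in the conductor; conversely, writing F - m = k
+ k' in Ω shows that no element of R : C has an exponent m ≤ F
(`canonicalSubmodule_mul_div_eq_iff`).

In minimal multiplicity the generators form a complete residue system modulo a_1, so F = a_v - a_1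
and the elements of Ω below a_1 are among the a_v - a_i with i ≥ 2. Since Ω + H ⊆ Ω, only sums below
a_1 matter, which gives the criterion (`forall_exists_add_eq_iff`).

The definition allows any canonical module between R and its closure, so C must be shown canonical
and essentially unique. Both rest on the pairing (x, y) ↦ coefficient of xy at F: it makes Q/C
injective, with Q = K((t)), and makes X ↦ C : X an involution on fractional ideals. A type-one X
then has cyclic dual, hence X ≅ C (`nonempty_equiv_canonicalSubmodule`). -/

/-! ### Numerical semigroups of minimal multiplicity -/

section NumericalSemigroup

variable {H : AddSubmonoid ℕ} {v : ℕ} {a : ℕ → ℕ}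

namespace IsMinimallyGeneratedBy

theorem mem (ha : IsMinimallyGeneratedBy H v a) {i : ℕ} (hi : i ∈ Set.Icc 1 v) : a i ∈ H := by
  rw [← ha.closure_eq]
  exact AddSubmonoid.subset_closure (Set.mem_image_of_mem a hi)

/-- A minimal generator is not a sum of two nonzero elements. -/
theorem add_ne (ha : IsMinimallyGeneratedBy H v a) {i : ℕ} (hi : i ∈ Set.Icc 1 v) {x y : ℕ}
    (hx : x ∈ H) (hy : y ∈ H) (hx0 : x ≠ 0) (hy0 : y ≠ 0) : x + y ≠ a i := by
  intro hxy
  set S := a '' Set.Icc 1 v with hS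
  have haS : a i ∈ S := Set.mem_image_of_mem a hi
  -- An element below `a i` cannot involve the generator `a i`. Applied to `x` and `y`, this makes
  -- `a i` redundant.
  have hlt : ∀ z ∈ H, z < a i → z ∈ AddSubmonoid.closure (S \ {a i}) := by
    intro z hz
    rw [← ha.closure_eq] at hz
    induction hz using AddSubmonoid.closure_induction with
    | mem z hz => exact fun h => AddSubmonoid.subset_closure ⟨hz, h.ne⟩
    | zero => exact fun _ => zero_mem _
    | add z w _ _ hz hw => exact fun h => add_mem (hz (by omega)) (hw (by omega))
  have hai : a i ∈ AddSubmonoid.closure (S \ {a i}) := by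
    have := add_mem (hlt x hx (by omega)) (hlt y hy (by omega))
    rwa [hxy] at this
  refine ha.minimal (S \ {a i}) ⟨Set.sdiff_subset, fun h => (h haS).2 rfl⟩ ?_
  rw [← ha.closure_eq]
  refine le_antisymm (AddSubmonoid.closure_mono Set.sdiff_subset)
    (AddSubmonoid.closure_le.2 fun z hz => ?_)
  by_cases h : z = a i
  · rw [h]
    exact hai
  · exact AddSubmonoid.subset_closure ⟨hz, h⟩

theorem two_le (ha : IsMinimallyGeneratedBy H v a) (hH : IsNumericalSemigroup H) (hne : H ≠ ⊤)
    (hmult : v = a 1) : 2 ≤ v := by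
  by_contra! h
  interval_cases v
  · have h0 : H = ⊥ := by
      rw [← ha.closure_eq]
      simp
    rw [h0] at hH
    have hfin : ({0} : Set ℕ).Finite := Set.finite_singleton 0
    exact Set.infinite_univ (α := ℕ) (by simpa using hfin.union hH)
  · refine hne (eq_top_iff.2 fun n _ => ?_)
    have := H.nsmul_mem (ha.mem (i := 1) (by simp)) n
    rwa [← hmult, smul_eq_mul, mul_one] at this

theorem mul_mem (ha : IsMinimallyGeneratedBy H v a) (hv : 1 ≤ v) (k : ℕ) : a 1 * k ∈ H := by
  have := H.nsmul_mem (ha.mem (i := 1) ⟨le_rfl, hv⟩) k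
  rwa [smul_eq_mul, mul_comm] at this

theorem le_apply (ha : IsMinimallyGeneratedBy H v a) {i : ℕ} (hi : i ∈ Set.Icc 1 v) :
    a 1 ≤ a i :=
  ha.strictMono.monotoneOn ⟨le_rfl, hi.1.trans hi.2⟩ hi hi.1

theorem apply_le (ha : IsMinimallyGeneratedBy H v a) {i : ℕ} (hi : i ∈ Set.Icc 1 v) :
    a i ≤ a v :=
  ha.strictMono.monotoneOn hi ⟨hi.1.trans hi.2, le_rfl⟩ hi.2

theorem lt_apply (ha : IsMinimallyGeneratedBy H v a) {i : ℕ} (hi : i ∈ Set.Icc 2 v) :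
    a 1 < a i :=
  ha.strictMono ⟨le_rfl, by have := hi.1; have := hi.2; omega⟩ ⟨by have := hi.1; omega, hi.2⟩ hi.1

/-- In minimal multiplicity, the minimal generators represent all residue classes modulo the
multiplicity. -/
theorem exists_mod_eq (ha : IsMinimallyGeneratedBy H v a) (hv : 2 ≤ v) (hmult : v = a 1) (n : ℕ) :
    ∃ i ∈ Set.Icc 1 v, a i % a 1 = n % a 1 := by
  classical
  -- Of two congruent generators, the larger would be the smaller plus a multiple of `a 1`, hence
  -- decomposable.
  have hlt : ∀ i ∈ Set.Icc 1 v, ∀ j ∈ Set.Icc 1 v, i < j → a i % a 1 ≠ a j % a 1 := by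
    intro i hi j hj hij h
    have hlt := ha.strictMono hi hj hij
    have hle := ha.le_apply hi
    obtain ⟨k, hk⟩ := (Nat.modEq_iff_dvd' hlt.le).1 h
    exact ha.add_ne hj (ha.mem hi) (ha.mul_mem (by omega) k) (by omega) (by omega)
      (by omega)
  have hinj : Set.InjOn (fun i => a i % a 1) (Finset.Icc 1 v : Finset ℕ) := by
    intro i hi j hj h
    rw [Finset.coe_Icc] at hi hj
    rcases lt_trichotomy i j with hij | hij | hij
    · exact absurd h (hlt i hi j hj hij)
    · exact hij
    · exact absurd h.symm (hlt j hj i hi hij)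
  -- Counting: `v = a 1` distinct residues exhaust all classes.
  have himg : (Finset.Icc 1 v).image (fun i => a i % a 1) = Finset.range (a 1) := by
    apply Finset.eq_of_subset_of_card_le
    · intro x hx
      obtain ⟨i, -, rfl⟩ := Finset.mem_image.1 hx
      exact Finset.mem_range.2 (Nat.mod_lt _ (by omega))
    · rw [Finset.card_image_of_injOn hinj]
      simp [← hmult]
  have hn : n % a 1 ∈ (Finset.Icc 1 v).image (fun i => a i % a 1) := by
    rw [himg]
    exact Finset.mem_range.2 (Nat.mod_lt _ (by omega))
  obtain ⟨i, hi, hin⟩ := Finset.mem_image.1 hn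
  exact ⟨i, by simpa using hi, hin⟩

theorem mem_of_mod_eq (ha : IsMinimallyGeneratedBy H v a) {i n : ℕ} (hi : i ∈ Set.Icc 1 v)
    (h : a i % a 1 = n % a 1) (hle : a i ≤ n) : n ∈ H := by
  obtain ⟨k, hk⟩ := (Nat.modEq_iff_dvd' hle).1 h
  have := add_mem (ha.mem hi) (ha.mul_mem (hi.1.trans hi.2) k)
  rwa [show a i + a 1 * k = n by omega] at this

theorem frobenius_notMem (ha : IsMinimallyGeneratedBy H v a) (hv : 2 ≤ v) (hmult : v = a 1) :
    a v - a 1 ∉ H := by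
  intro h
  have := ha.lt_apply (i := v) ⟨hv, le_rfl⟩
  exact ha.add_ne (i := v) ⟨by omega, le_rfl⟩ (ha.mem (i := 1) ⟨le_rfl, by omega⟩) h
    (by omega) (by omega) (by omega)

/-- If the generator `a i` congruent to `n` exceeded `n`, then `n ≤ a i - a 1 ≤ a v - a 1`. With
`frobenius_notMem`, this identifies `a v - a 1` as the Frobenius number. -/
theorem mem_of_frobenius_lt (ha : IsMinimallyGeneratedBy H v a) (hv : 2 ≤ v) (hmult : v = a 1)
    {n : ℕ} (hn : a v - a 1 < n) : n ∈ H := by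
  obtain ⟨i, hi, hin⟩ := ha.exists_mod_eq hv hmult n
  rcases le_or_gt (a i) n with h | h
  · exact ha.mem_of_mod_eq hi hin h
  · obtain ⟨k, hk⟩ := (Nat.modEq_iff_dvd' h.le).1 hin.symm
    have hle := ha.apply_le hi
    have hk0 : k ≠ 0 := by
      rintro rfl
      omega
    have := Nat.le_mul_of_pos_right (a 1) (Nat.pos_of_ne_zero hk0)
    omega

/-- Equality would rearrange to `h + a 1 = a i`, decomposing a minimal generator. Thus `a v - a i`
lies in Ω. -/
theorem add_ne_frobenius (ha : IsMinimallyGeneratedBy H v a) (hmult : v = a 1) {i : ℕ}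
    (hi : i ∈ Set.Icc 2 v) {h : ℕ} (hh : h ∈ H) : h + (a v - a i) ≠ a v - a 1 := by
  intro heq
  have h1 := ha.lt_apply hi
  have hi' : i ∈ Set.Icc 1 v := ⟨by have := hi.1; omega, hi.2⟩
  have h2 := ha.apply_le hi'
  have hv := hi.1.trans hi.2
  exact ha.add_ne hi' hh (ha.mem (i := 1) ⟨le_rfl, by omega⟩) (by omega) (by omega) (by omega)

/-- Converse of `add_ne_frobenius` below `a 1`. Take the generator congruent to `a v - k`: if
smaller, it puts `a v - a 1 - k` in `H`; if larger, it exceeds `a v` because `k < a 1`. -/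
theorem exists_add_eq (ha : IsMinimallyGeneratedBy H v a) (hv : 2 ≤ v) (hmult : v = a 1) {k : ℕ}
    (hk : k < a 1) (hkF : ∀ h ∈ H, h + k ≠ a v - a 1) : ∃ i ∈ Set.Icc 2 v, k + a i = a v := by
  have h1v := ha.lt_apply (i := v) ⟨hv, le_rfl⟩
  obtain ⟨i, hi, hin⟩ := ha.exists_mod_eq hv hmult (a v - k)
  rcases lt_trichotomy (a i) (a v - k) with h | h | h
  · obtain ⟨s, hs⟩ := (Nat.modEq_iff_dvd' h.le).1 hin
    obtain ⟨s, rfl⟩ : ∃ s', s = s' + 1 := ⟨s - 1, by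
      have : s ≠ 0 := by
        rintro rfl
        omega
      omega⟩
    rw [mul_add, mul_one] at hs
    exact absurd (by omega) (hkF _ (add_mem (ha.mem hi) (ha.mul_mem (by omega) s)))
  · refine ⟨i, ⟨?_, hi.2⟩, by omega⟩
    by_contra! hi2
    obtain rfl : i = 1 := by have := hi.1; omega
    exact hkF 0 H.zero_mem (by omega)
  · obtain ⟨s, hs⟩ := (Nat.modEq_iff_dvd' h.le).1 hin.symm
    have hle := ha.apply_le hi
    have hs0 : s ≠ 0 := by
      rintro rfl
      omega
    have := Nat.le_mul_of_pos_right (a 1) (Nat.pos_of_ne_zero hs0)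
    omega

/-- The numerical criterion for `K + K = ℕ` in minimal multiplicity. -/
theorem forall_exists_add_eq_iff (ha : IsMinimallyGeneratedBy H v a) (hv : 2 ≤ v)
    (hmult : v = a 1) :
    (∀ n : ℕ, ∃ i j : ℕ, i + j = n ∧ (∀ h ∈ H, h + i ≠ a v - a 1) ∧
      ∀ h ∈ H, h + j ≠ a v - a 1) ↔
      Set.Icc (2 * a v - a 1 + 1) (2 * a v) ⊆
        {n | ∃ i ∈ Set.Icc 2 v, ∃ j ∈ Set.Icc 2 v, n = a i + a j} := by
  have h1v := ha.lt_apply (i := v) ⟨hv, le_rfl⟩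
  constructor
  · rintro h n ⟨hn1, hn2⟩
    -- The range of `n` makes `2 * a v - n`, and so both summands, smaller than `a 1`.
    obtain ⟨i, j, hij, hi, hj⟩ := h (2 * a v - n)
    obtain ⟨i', hi', hii⟩ := ha.exists_add_eq hv hmult (by omega) hi
    obtain ⟨j', hj', hjj⟩ := ha.exists_add_eq hv hmult (by omega) hj
    exact ⟨i', hi', j', hj', by omega⟩
  · intro h n
    have hmod := Nat.mod_lt n (show 0 < a 1 by omega)
    obtain ⟨i, hi, j, hj, hij⟩ := h (show 2 * a v - n % a 1 ∈ _ from ⟨by omega, by omega⟩)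
    have hi2 := ha.apply_le (i := i) ⟨by have := hi.1; omega, hi.2⟩
    have hj2 := ha.apply_le (i := j) ⟨by have := hj.1; omega, hj.2⟩
    have hdiv := Nat.mod_add_div n (a 1)
    -- The hypothesis decomposes `n % a 1`; the remaining multiple of `a 1` is absorbed by one
    -- summand, as Ω + H ⊆ Ω.
    refine ⟨a v - a i, a v - a j + a 1 * (n / a 1), by omega,
      fun x hx => ha.add_ne_frobenius hmult hi hx, fun x hx => ?_⟩
    have := ha.add_ne_frobenius hmult hj (add_mem hx (ha.mul_mem (by omega) (n / a 1)))
    omega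

end IsMinimallyGeneratedBy

end NumericalSemigroup

/-! ### Ext through an embedding in an injective module -/

section ExtOfInjective

open CategoryTheory

variable {R : Type u} [CommRing R]

theorem shortExact_submodule_quotient {Q : Type u} [AddCommGroup Q] [Module R Q]
    (X : Submodule R Q) :
    (ShortComplex.mk (ModuleCat.ofHom X.subtype) (ModuleCat.ofHom X.mkQ)
      (by ext x; simp)).ShortExact where
  exact := by
    rw [ShortComplex.moduleCat_exact_iff_range_eq_ker]
    simp
  mono_f := (ModuleCat.mono_iff_injective _).2 X.subtype_injective
  epi_g := (ModuleCat.epi_iff_surjective _).2 X.mkQ_surjective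

/-- If `Q` is an injective module without nonzero maps from `k`, then
`Ext¹(k, X) ≃ Hom(k, Q / X)` for every submodule `X` of `Q`. -/
theorem nonempty_ext_one_equiv (k : Type u) [AddCommGroup k] [Module R k]
    {Q : Type u} [AddCommGroup Q] [Module R Q] [Module.Injective R Q]
    (X : Submodule R Q) (h0 : ∀ f : k →ₗ[R] Q, f = 0) :
    Nonempty (Abelian.Ext (ModuleCat.of R k) (ModuleCat.of R X) 1 ≃ₗ[R] (k →ₗ[R] Q ⧸ X)) := by
  have hS := shortExact_submodule_quotient X
  have : Injective (ModuleCat.of R Q) := Module.injective_object_of_injective_module R Q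
  let δ : Abelian.Ext (ModuleCat.of R k) (ModuleCat.of R (Q ⧸ X)) 0 →ₗ[R]
      Abelian.Ext (ModuleCat.of R k) (ModuleCat.of R X) 1 :=
    Abelian.Ext.postcompOfLinear hS.extClass R (ModuleCat.of R k) (zero_add 1)
  -- Injectivity comes from Hom(k, Q) = 0, surjectivity from Ext¹(k, Q) = 0.
  have hδ : Function.Bijective δ := by
    constructor
    · rw [injective_iff_map_eq_zero]
      intro x hx
      obtain ⟨y, hy⟩ := Abelian.Ext.covariant_sequence_exact₃ _ hS x (zero_add 1) hx
      have hy0 : y = 0 := by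
        obtain ⟨f, rfl⟩ := Abelian.Ext.addEquiv₀.symm.surjective y
        have hf : f = 0 := ModuleCat.hom_ext (h0 f.hom)
        rw [hf, map_zero]
      rw [← hy, hy0, Abelian.Ext.zero_comp]
    · intro x
      exact Abelian.Ext.covariant_sequence_exact₁ _ hS x (Abelian.Ext.eq_zero_of_injective _) rfl
  exact ⟨(LinearEquiv.ofBijective δ hδ).symm ≪≫ₗ Abelian.Ext.linearEquiv₀ ≪≫ₗ
    ModuleCat.homLinearEquiv⟩

theorem subsingleton_ext_zero {k X : Type u} [AddCommGroup k] [Module R k]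
    [AddCommGroup X] [Module R X] (h0 : ∀ f : k →ₗ[R] X, f = 0) :
    Subsingleton (Abelian.Ext (ModuleCat.of R k) (ModuleCat.of R X) 0) := by
  refine subsingleton_of_forall_eq 0 fun y => ?_
  obtain ⟨f, rfl⟩ := Abelian.Ext.addEquiv₀.symm.surjective y
  have hf : f = 0 := ModuleCat.hom_ext (h0 f.hom)
  rw [hf, map_zero]

/-- `0 → X → Q → Q / X → 0` is an injective resolution of length one. -/
theorem subsingleton_ext_add_two (k : Type u) [AddCommGroup k] [Module R k]
    {Q : Type u} [AddCommGroup Q] [Module R Q] [Module.Injective R Q]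
    (X : Submodule R Q) [Module.Injective R (Q ⧸ X)] (n : ℕ) :
    Subsingleton (Abelian.Ext (ModuleCat.of R k) (ModuleCat.of R X) (n + 2)) := by
  have hS := shortExact_submodule_quotient X
  have : Injective (ModuleCat.of R Q) := Module.injective_object_of_injective_module R Q
  have : Injective (ModuleCat.of R (Q ⧸ X)) :=
    Module.injective_object_of_injective_module R (Q ⧸ X)
  refine subsingleton_of_forall_eq 0 fun x => ?_
  obtain ⟨y, rfl⟩ := Abelian.Ext.covariant_sequence_exact₁ _ hS x
    (Abelian.Ext.eq_zero_of_injective _) (n₀ := n + 1) rfl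
  have hy : y = 0 := Abelian.Ext.eq_zero_of_injective (I := ModuleCat.of R (Q ⧸ X)) y
  rw [hy, Abelian.Ext.zero_comp]

theorem nonempty_ext_equiv_of_linearEquiv {k M N : Type u} [AddCommGroup k] [Module R k]
    [AddCommGroup M] [Module R M] [AddCommGroup N] [Module R N] (e : M ≃ₗ[R] N) (i : ℕ) :
    Nonempty (Abelian.Ext (ModuleCat.of R k) (ModuleCat.of R M) i ≃ₗ[R]
      Abelian.Ext (ModuleCat.of R k) (ModuleCat.of R N) i) := by
  let f := Abelian.Ext.postcompOfLinear (Abelian.Ext.mk₀ (ModuleCat.ofHom e.toLinearMap)) R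
    (ModuleCat.of R k) (add_zero i)
  let g := Abelian.Ext.postcompOfLinear (Abelian.Ext.mk₀ (ModuleCat.ofHom e.symm.toLinearMap)) R
    (ModuleCat.of R k) (add_zero i)
  refine ⟨LinearEquiv.ofLinearMap f g ?_ ?_⟩
  · ext x
    simp [f, g, ← ModuleCat.ofHom_comp]
  · ext x
    simp [f, g, ← ModuleCat.ofHom_comp]

theorem IsCanonicalModule.of_linearEquiv [IsLocalRing R] {M N : Type u} [AddCommGroup M]
    [Module R M] [AddCommGroup N] [Module R N] (h : IsCanonicalModule R M) (e : M ≃ₗ[R] N) :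
    IsCanonicalModule R N where
  finite := have := h.finite; Module.Finite.equiv e
  ext_dim i hi := by
    obtain ⟨f⟩ := nonempty_ext_equiv_of_linearEquiv (k := IsLocalRing.ResidueField R) e i
    obtain ⟨g⟩ := h.ext_dim i hi
    exact ⟨f.symm ≪≫ₗ g⟩
  ext_ne_dim i hi := by
    obtain ⟨f⟩ := nonempty_ext_equiv_of_linearEquiv (k := IsLocalRing.ResidueField R) e i
    have := h.ext_ne_dim i hi
    exact f.symm.toEquiv.subsingleton

end ExtOfInjective

/-! ### Trace ideals in a field of fractions -/

section TraceIdeal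

variable {R : Type u} [CommRing R]

theorem traceIdeal_le_of_linearEquiv {M N : Type*} [AddCommGroup M] [Module R M]
    [AddCommGroup N] [Module R N] (e : M ≃ₗ[R] N) : traceIdeal R M ≤ traceIdeal R N := by
  refine iSup_le fun f => ?_
  refine le_trans ?_ (le_iSup _ (f ∘ₗ e.symm.toLinearMap))
  rintro _ ⟨x, rfl⟩
  exact ⟨e x, by simp⟩

theorem traceIdeal_congr {M N : Type*} [AddCommGroup M] [Module R M]
    [AddCommGroup N] [Module R N] (e : M ≃ₗ[R] N) : traceIdeal R M = traceIdeal R N :=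
  le_antisymm (traceIdeal_le_of_linearEquiv e) (traceIdeal_le_of_linearEquiv e.symm)

/-- Inside a field of fractions `L`, the trace ideal of a module `1 ≤ C ≤ L` is `C (R : C)`. -/
theorem map_traceIdeal_eq_mul_div [IsDomain R] {L : Type*} [Field L] [Algebra R L]
    [IsFractionRing R L] (C : Submodule R L) (hC : 1 ≤ C) :
    Submodule.map (Algebra.linearMap R L) (traceIdeal R C) = C * (1 / C) := by
  have h1 : (1 : L) ∈ C := hC (Submodule.one_le.1 le_rfl)
  apply le_antisymm
  · rw [traceIdeal, Submodule.map_iSup]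
    refine iSup_le fun f => ?_
    -- A linear map on `C` is multiplication by its value at 1: clear the denominator of `c`.
    have key : ∀ c : C, algebraMap R L (f c) = c * algebraMap R L (f ⟨1, h1⟩) := by
      intro c
      obtain ⟨a, b, hb, hab⟩ := IsFractionRing.div_surjective (A := R) (c : L)
      have hb' : algebraMap R L b ≠ 0 := by
        simpa using nonZeroDivisors.ne_zero hb
      have hbc : b • c = a • (⟨1, h1⟩ : C) := by
        apply Subtype.ext
        simp only [Submodule.coe_smul, Algebra.smul_def, ← hab]
        field_simp
      have := congrArg (fun z => algebraMap R L (f z)) hbc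
      simp only [map_smul, smul_eq_mul, map_mul] at this
      rw [← hab]
      field_simp
      linear_combination this
    rintro _ ⟨_, ⟨c, rfl⟩, rfl⟩
    rw [Algebra.linearMap_apply, key]
    refine Submodule.mul_mem_mul c.2 ?_
    rw [Submodule.mem_div_iff_forall_mul_mem]
    intro y hy
    rw [mul_comm, ← key ⟨y, hy⟩]
    exact Submodule.algebraMap_mem _
  · rw [Submodule.mul_le]
    intro c hc d hd
    rw [Submodule.mem_div_iff_forall_mul_mem] at hd
    let g : C →ₗ[R] (1 : Submodule R L) :=
      (LinearMap.mulLeft R d).restrict (p := C) (q := 1) hd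
    have hinj : Function.Injective (Algebra.linearMap R L) := IsFractionRing.injective R L
    let e : R ≃ₗ[R] LinearMap.range (Algebra.linearMap R L) := LinearEquiv.ofInjective _ hinj
    have h1r : (1 : Submodule R L) = LinearMap.range (Algebra.linearMap R L) :=
      Submodule.one_eq_range
    let f : C →ₗ[R] R := e.symm.toLinearMap ∘ₗ (LinearEquiv.ofEq _ _ h1r).toLinearMap ∘ₗ g
    refine ⟨f ⟨c, hc⟩, (le_iSup (fun f : C →ₗ[R] R => LinearMap.range f) f) ⟨_, rfl⟩, ?_⟩
    have h2 : ((e (f ⟨c, hc⟩)) : L) = d * c := by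
      simp only [f, LinearMap.comp_apply, LinearEquiv.coe_coe, LinearEquiv.apply_symm_apply]
      rfl
    rw [mul_comm c d, ← h2]
    rfl

/-- The property of being far-flung Gorenstein may be tested in any field of fractions. -/
theorem isFarFlungGorenstein_iff_of_isFractionRing [IsDomain R] [IsLocalRing R] (L : Type u)
    [Field L] [Algebra R L] [IsFractionRing R L] :
    IsFarFlungGorenstein R ↔ IsNoetherianRing R ∧ ringKrullDim R = 1 ∧
      (∃ x ∈ IsLocalRing.maximalIdeal R, x ∈ nonZeroDivisors R) ∧
      Module.Finite R (Subalgebra.toSubmodule (integralClosure R L)) ∧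
      ∃ C : Submodule R L, 1 ≤ C ∧ C ≤ Subalgebra.toSubmodule (integralClosure R L) ∧
        IsCanonicalModule R C ∧ Submodule.map (Algebra.linearMap R L) (traceIdeal R C) =
          1 / Subalgebra.toSubmodule (integralClosure R L) := by
  let e : FractionRing R ≃ₐ[R] L := FractionRing.algEquiv R L
  have hint : (integralClosureQ R).map e.toLinearMap =
      Subalgebra.toSubmodule (integralClosure R L) := by
    ext x
    simp only [integralClosureQ, Submodule.mem_map, Subalgebra.mem_toSubmodule,
      AlgEquiv.toLinearMap_apply, mem_integralClosure_iff]
    constructor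
    · rintro ⟨y, hy, rfl⟩
      exact hy.map e
    · intro hx
      exact ⟨e.symm x, hx.map e.symm, by simp⟩
  have hone : (1 : Submodule R (FractionRing R)).map e.toLinearMap = 1 :=
    Submodule.map_one e.toAlgHom
  have heinj : Function.Injective e.toLinearMap := e.injective
  have hmap : ∀ I : Ideal R,
      (Submodule.map (Algebra.linearMap R (FractionRing R)) I).map e.toLinearMap =
      Submodule.map (Algebra.linearMap R L) I := by
    intro I
    rw [← Submodule.map_comp]
    congr 1
    ext
    simp
  have eqv : ∀ C : Submodule R (FractionRing R), Nonempty (C ≃ₗ[R] C.map e.toLinearMap) :=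
    fun C => ⟨Submodule.equivMapOfInjective e.toLinearMap heinj C⟩
  have hcan : ∀ C : Submodule R (FractionRing R),
      (1 ≤ C ∧ C ≤ integralClosureQ R ∧ IsCanonicalModule R C ∧
        Submodule.map (Algebra.linearMap R (FractionRing R)) (traceIdeal R C) =
          (1 : Submodule R (FractionRing R)) / integralClosureQ R) ↔
      (1 ≤ C.map e.toLinearMap ∧
        C.map e.toLinearMap ≤ Subalgebra.toSubmodule (integralClosure R L) ∧
        IsCanonicalModule R (C.map e.toLinearMap) ∧
        Submodule.map (Algebra.linearMap R L) (traceIdeal R (C.map e.toLinearMap)) =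
          1 / Subalgebra.toSubmodule (integralClosure R L)) := by
    intro C
    obtain ⟨f⟩ := eqv C
    rw [← hint, ← hone, Submodule.map_le_map_iff_of_injective heinj,
      Submodule.map_le_map_iff_of_injective heinj, ← Submodule.map_div,
      ← traceIdeal_congr f, ← hmap, (Submodule.map_injective_of_injective heinj).eq_iff]
    exact and_congr_right fun _ => and_congr_right fun _ => and_congr_left fun _ =>
      ⟨fun h => h.of_linearEquiv f, fun h => h.of_linearEquiv f.symm⟩
  have hfin : Module.Finite R (integralClosureQ R) ↔
      Module.Finite R (Subalgebra.toSubmodule (integralClosure R L)) := by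
    obtain ⟨f⟩ := eqv (integralClosureQ R)
    rw [hint] at f
    exact ⟨fun h => Module.Finite.equiv f, fun h => Module.Finite.equiv f.symm⟩
  constructor
  · rintro ⟨h1, h2, h3, h4, C, hC⟩
    exact ⟨h1, h2, h3, hfin.1 h4, _, (hcan C).1 hC⟩
  · rintro ⟨h1, h2, h3, h4, C, hC⟩
    refine ⟨h1, h2, h3, hfin.2 h4, C.map e.symm.toLinearMap, (hcan _).2 ?_⟩
    have : (C.map e.symm.toLinearMap).map e.toLinearMap = C := by
      rw [← Submodule.map_comp]
      convert Submodule.map_id C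
      ext x
      simp
    rwa [this]

end TraceIdeal

/-! ### Socles, and injectivity of the fraction field -/

section Socle

variable {R : Type u} [CommRing R] [IsLocalRing R]

open IsLocalRing

/-- The map from the residue field to `M` determined by an element killed by the maximal ideal. -/
noncomputable def residueFieldLift {M : Type*} [AddCommGroup M] [Module R M] (y : M)
    (hy : ∀ r ∈ maximalIdeal R, r • y = 0) : ResidueField R →ₗ[R] M :=
  Submodule.liftQ (maximalIdeal R) (LinearMap.toSpanSingleton R M y) fun r hr => hy r hr

theorem residueFieldLift_residue {M : Type*} [AddCommGroup M] [Module R M] (y : M)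
    (hy : ∀ r ∈ maximalIdeal R, r • y = 0) (r : R) :
    residueFieldLift y hy (residue R r) = r • y := rfl

theorem residueField_linearMap_ext {M : Type*} [AddCommGroup M] [Module R M]
    {f g : ResidueField R →ₗ[R] M} (h : f (residue R 1) = g (residue R 1)) : f = g := by
  ext x
  obtain ⟨r, rfl⟩ := residue_surjective x
  have : residue R r = r • residue R 1 := by
    rw [map_one, Algebra.smul_def, mul_one]
    rfl
  rw [this, map_smul, map_smul, h]

theorem smul_residueField_map_eq_zero {M : Type*} [AddCommGroup M] [Module R M]
    (f : ResidueField R →ₗ[R] M) (x : ResidueField R) {r : R} (hr : r ∈ maximalIdeal R) :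
    r • f x = 0 := by
  rw [← map_smul, Algebra.smul_def]
  have : algebraMap R (ResidueField R) r = 0 := (residue_eq_zero_iff r).2 hr
  rw [this, zero_mul, map_zero]

theorem residueField_linearMap_eq_zero {L : Type*} [AddCommGroup L] [Module R L]
    {r : R} (hr : r ∈ maximalIdeal R) (hL : ∀ x : L, r • x = 0 → x = 0)
    (f : ResidueField R →ₗ[R] L) : f = 0 := by
  ext x
  exact hL _ (smul_residueField_map_eq_zero f x hr)

/-- If `Hom(k, Q / X)` is isomorphic to `k`, then the socle of `Q / X` is generated by each
of its nonzero elements. -/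
theorem exists_sub_smul_mem_of_equiv {Q : Type*} [AddCommGroup Q] [Module R Q] {X : Submodule R Q}
    (e : (ResidueField R →ₗ[R] Q ⧸ X) ≃ₗ[R] ResidueField R) {y z : Q} (hyX : y ∉ X)
    (hy : ∀ r ∈ maximalIdeal R, r • y ∈ X) (hz : ∀ r ∈ maximalIdeal R, r • z ∈ X) :
    ∃ r : R, z - r • y ∈ X := by
  have hlift : ∀ w : Q, (∀ r ∈ maximalIdeal R, r • w ∈ X) →
      ∀ r ∈ maximalIdeal R, r • X.mkQ w = 0 := by
    intro w hw r hr
    rw [← map_smul]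
    exact (Submodule.Quotient.mk_eq_zero X).2 (hw r hr)
  let φ := residueFieldLift (X.mkQ y) (hlift y hy)
  let ψ := residueFieldLift (X.mkQ z) (hlift z hz)
  have hφ : φ ≠ 0 := by
    intro h
    have := residueFieldLift_residue (X.mkQ y) (hlift y hy) 1
    change φ _ = _ at this
    rw [h, one_smul] at this
    exact hyX (by simpa using this.symm)
  have hφ' : e φ ≠ 0 := by simpa using hφ
  obtain ⟨r, hr⟩ := residue_surjective (e ψ / e φ)
  refine ⟨r, ?_⟩
  have : ψ = r • φ := by
    apply e.injective
    rw [map_smul, Algebra.smul_def]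
    change _ = residue R r * _
    rw [hr, div_mul_cancel₀ _ hφ']
  have h2 := residueFieldLift_residue (X.mkQ z) (hlift z hz) 1
  have h3 := residueFieldLift_residue (X.mkQ y) (hlift y hy) 1
  change ψ _ = _ at h2
  change φ _ = _ at h3
  rw [this, LinearMap.smul_apply, h3, one_smul, one_smul, ← map_smul] at h2
  simpa using (Submodule.Quotient.eq X).1 h2.symm

/-- If the socle of `Q / X` is generated by the class of `y ∉ X`, then `Hom(k, Q / X) ≃ k`. -/
theorem nonempty_residueField_equiv {Q : Type*} [AddCommGroup Q] [Module R Q]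
    {X : Submodule R Q} {y : Q} (hyX : y ∉ X) (hy : ∀ r ∈ maximalIdeal R, r • y ∈ X)
    (h : ∀ z : Q, (∀ r ∈ maximalIdeal R, r • z ∈ X) → ∃ r : R, z - r • y ∈ X) :
    Nonempty ((ResidueField R →ₗ[R] Q ⧸ X) ≃ₗ[R] ResidueField R) := by
  have hlift : ∀ r ∈ maximalIdeal R, r • X.mkQ y = 0 := by
    intro r hr
    rw [← map_smul]
    exact (Submodule.Quotient.mk_eq_zero X).2 (hy r hr)
  let φ := residueFieldLift (X.mkQ y) hlift
  have hφ1 : φ (residue R 1) = X.mkQ y :=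
    (residueFieldLift_residue (X.mkQ y) hlift 1).trans (one_smul R _)
  let T : R →ₗ[R] (ResidueField R →ₗ[R] Q ⧸ X) := LinearMap.toSpanSingleton R _ φ
  have hT : Function.Surjective T := by
    intro f
    obtain ⟨z, hz⟩ := X.mkQ_surjective (f (residue R 1))
    obtain ⟨r, hr⟩ := h z fun r hr => by
      have := smul_residueField_map_eq_zero f (residue R 1) hr
      rw [← hz, ← map_smul] at this
      exact (Submodule.Quotient.mk_eq_zero X).1 this
    refine ⟨r, residueField_linearMap_ext ?_⟩
    simp only [T, LinearMap.toSpanSingleton_apply, LinearMap.smul_apply, hφ1, ← hz, ← map_smul]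
    exact ((Submodule.Quotient.eq X).2 hr).symm
  have hker : LinearMap.ker T = maximalIdeal R := by
    refine ((maximalIdeal.isMaximal R).eq_of_le ?_ ?_).symm
    · intro h1
      have : T 1 = 0 := by
        rw [← LinearMap.mem_ker, h1]
        trivial
      simp only [T, LinearMap.toSpanSingleton_apply, one_smul] at this
      rw [this] at hφ1
      exact hyX (by simpa using hφ1.symm)
    · intro r hr
      refine residueField_linearMap_ext ?_
      simp only [T, LinearMap.toSpanSingleton_apply, LinearMap.smul_apply, hφ1, hlift r hr,
        LinearMap.zero_apply]
  exact ⟨(LinearMap.quotKerEquivOfSurjective T hT).symm ≪≫ₗ Submodule.quotEquivOfEq _ _ hker⟩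

/-- A fraction field is an injective module. -/
theorem injective_of_isFractionRing {R : Type u} [CommRing R] [IsDomain R] (L : Type u) [Field L]
    [Algebra R L] [IsFractionRing R L] : Module.Injective R L := by
  refine Module.Baer.injective fun I g => ?_
  by_cases hI : ∃ a ∈ I, a ≠ 0
  · obtain ⟨a, ha, ha0⟩ := hI
    have ha' : algebraMap R L a ≠ 0 := by simpa using ha0
    -- The ratio `g x / x` does not depend on the nonzero `x ∈ I`, because `a • g x = x • g a`.
    refine ⟨LinearMap.toSpanSingleton R L (g ⟨a, ha⟩ / algebraMap R L a), fun x hx => ?_⟩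
    have hxa : x • (⟨a, ha⟩ : I) = a • (⟨x, hx⟩ : I) := Subtype.ext (mul_comm x a)
    have h2 := congrArg g hxa
    rw [map_smul, map_smul, Algebra.smul_def, Algebra.smul_def] at h2
    rw [LinearMap.toSpanSingleton_apply, Algebra.smul_def]
    field_simp
    linear_combination h2
  · push Not at hI
    refine ⟨0, fun x hx => ?_⟩
    have : (⟨x, hx⟩ : I) = 0 := Subtype.ext (hI x hx)
    rw [this, map_zero, LinearMap.zero_apply]

end Socle

/-! ### The semigroup ring inside the field of Laurent series -/

section SemigroupRing

open IsLocalRing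

variable {K : Type u} [Field K]

theorem LaurentSeries.exists_coeff_ne_zero_of_coeff_mul_ne_zero {x y : LaurentSeries K} {n : ℤ}
    (h : (x * y).coeff n ≠ 0) : ∃ i j : ℤ, i + j = n ∧ x.coeff i ≠ 0 ∧ y.coeff j ≠ 0 := by
  rw [HahnSeries.coeff_mul] at h
  obtain ⟨p, hp, hne⟩ := Finset.exists_ne_zero_of_sum_ne_zero h
  exact ⟨p.1, p.2, (Finset.mem_antidiagonal.1 hp).2.2, left_ne_zero_of_mul hne,
    right_ne_zero_of_mul hne⟩

theorem LaurentSeries.exists_forall_lt_coeff_eq_zero (x : LaurentSeries K) :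
    ∃ n : ℤ, ∀ i < n, x.coeff i = 0 :=
  ⟨x.order, fun _ hi => HahnSeries.coeff_eq_zero_of_lt_order hi⟩

variable {H : AddSubmonoid ℕ}

theorem exists_mem_of_coeff_algebraMap_ne_zero (r : semigroupRing K H) {n : ℤ}
    (h : (algebraMap (semigroupRing K H) (LaurentSeries K) r).coeff n ≠ 0) :
    ∃ m ∈ H, (m : ℤ) = n := by
  change (HahnSeries.ofPowerSeries ℤ K (r : PowerSeries K)).coeff n ≠ 0 at h
  rw [PowerSeries.coeff_coe] at h
  split_ifs at h with hn
  · exact absurd rfl h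
  · exact ⟨n.natAbs, r.2 _ h, by omega⟩

theorem exists_algebraMap_eq {x : LaurentSeries K}
    (hx : ∀ n : ℤ, x.coeff n ≠ 0 → ∃ m ∈ H, (m : ℤ) = n) :
    ∃ r : semigroupRing K H, algebraMap (semigroupRing K H) (LaurentSeries K) r = x := by
  refine ⟨⟨PowerSeries.mk fun n => x.coeff n, fun n hn => ?_⟩, ?_⟩
  · rw [PowerSeries.coeff_mk] at hn
    obtain ⟨m, hm, hmn⟩ := hx _ hn
    rwa [← Nat.cast_injective (R := ℤ) hmn]
  · ext n
    change (HahnSeries.ofPowerSeries ℤ K (PowerSeries.mk fun n : ℕ => x.coeff n)).coeff n = _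
    rw [PowerSeries.coeff_coe]
    split_ifs with hn
    · by_contra h
      obtain ⟨m, -, hm⟩ := hx n (Ne.symm h)
      omega
    · rw [PowerSeries.coeff_mk]
      congr 1
      omega

instance isScalarTower_semigroupRing_laurentSeries :
    IsScalarTower K (semigroupRing K H) (LaurentSeries K) := by
  refine ⟨fun c r x => ?_⟩
  have h : algebraMap (semigroupRing K H) (LaurentSeries K) (c • r) =
      c • algebraMap (semigroupRing K H) (LaurentSeries K) r :=
    PowerSeries.coe_smul c (r : PowerSeries K)
  rw [Algebra.smul_def (c • r), Algebra.smul_def r, h, ← HahnSeries.single_zero_mul_eq_smul,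
    mul_assoc, HahnSeries.single_zero_mul_eq_smul]

/-- The monomial `t ^ h` of `K[[H]]`. -/
noncomputable def semigroupRing.monomial (K : Type u) [Field K] {H : AddSubmonoid ℕ} (h : H) :
    semigroupRing K H :=
  ⟨PowerSeries.monomial (h : ℕ) 1, fun n hn => by
    rw [PowerSeries.coeff_monomial] at hn
    split_ifs at hn with hnh
    · exact hnh ▸ h.2
    · exact absurd rfl hn⟩

theorem algebraMap_monomial (h : H) :
    algebraMap (semigroupRing K H) (LaurentSeries K) (semigroupRing.monomial K h) =
      HahnSeries.single ((h : ℕ) : ℤ) 1 := by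
  ext n
  change (HahnSeries.ofPowerSeries ℤ K (PowerSeries.monomial (h : ℕ) 1)).coeff n = _
  rw [PowerSeries.coeff_coe, HahnSeries.coeff_single, PowerSeries.coeff_monomial]
  split_ifs <;> first | rfl | omega

variable (K H) in
/-- The Laurent series of order at least `n`. -/
def orderGE (n : ℤ) : Submodule (semigroupRing K H) (LaurentSeries K) where
  carrier := {x | ∀ i < n, x.coeff i = 0}
  add_mem' := by
    intro x y hx hy i hi
    rw [HahnSeries.coeff_add, hx i hi, hy i hi, add_zero]
  zero_mem' := fun _ _ => rfl
  smul_mem' := by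
    intro r x hx i hi
    by_contra h
    rw [Algebra.smul_def] at h
    obtain ⟨a, b, hab, ha, hb⟩ := LaurentSeries.exists_coeff_ne_zero_of_coeff_mul_ne_zero h
    obtain ⟨m, -, hm⟩ := exists_mem_of_coeff_algebraMap_ne_zero r ha
    exact hb (hx b (by omega))

theorem mul_mem_orderGE {m n : ℤ} {x y : LaurentSeries K} (hx : x ∈ orderGE K H m)
    (hy : y ∈ orderGE K H n) : x * y ∈ orderGE K H (m + n) := by
  intro i hi
  by_contra h
  obtain ⟨a, b, hab, ha, hb⟩ := LaurentSeries.exists_coeff_ne_zero_of_coeff_mul_ne_zero h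
  have h1 : ¬ a < m := fun h' => ha (hx a h')
  have h2 : ¬ b < n := fun h' => hb (hy b h')
  omega

theorem orderGE_anti {m n : ℤ} (h : m ≤ n) : orderGE K H n ≤ orderGE K H m :=
  fun _ hx i hi => hx i (hi.trans_le h)

theorem single_mem_orderGE {m n : ℤ} (h : m ≤ n) (c : K) :
    HahnSeries.single n c ∈ orderGE K H m := by
  intro i hi
  rw [HahnSeries.coeff_single, if_neg (by omega)]

theorem exists_mem_orderGE (x : LaurentSeries K) : ∃ n : ℤ, x ∈ orderGE K H n :=
  x.exists_forall_lt_coeff_eq_zero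

theorem algebraMap_mem_orderGE (r : semigroupRing K H) :
    algebraMap (semigroupRing K H) (LaurentSeries K) r ∈ orderGE K H 0 := by
  intro i hi
  by_contra h
  obtain ⟨m, -, hm⟩ := exists_mem_of_coeff_algebraMap_ne_zero r h
  omega

theorem pow_mem_orderGE {x : LaurentSeries K} (hx : x ∈ orderGE K H 1) (n : ℕ) :
    x ^ n ∈ orderGE K H n := by
  induction n with
  | zero =>
    rw [pow_zero]
    exact single_mem_orderGE le_rfl 1
  | succ n ih =>
    rw [pow_succ]
    exact_mod_cast mul_mem_orderGE ih hx

theorem exists_orderGE_mul_inv (x : LaurentSeries K) :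
    ∃ n : ℤ, ∀ m : ℤ, ∀ y ∈ orderGE K H (m + n), x⁻¹ * y ∈ orderGE K H m := by
  obtain ⟨n, hn⟩ := exists_mem_orderGE (H := H) x⁻¹
  refine ⟨-n, fun m y hy => ?_⟩
  have := mul_mem_orderGE hn hy
  rwa [show n + (m + -n) = m by ring] at this

theorem mem_maximalIdeal_iff_coeff (r : semigroupRing K H) :
    r ∈ maximalIdeal (semigroupRing K H) ↔
      (algebraMap (semigroupRing K H) (LaurentSeries K) r).coeff 0 = 0 := by
  have h0 : (algebraMap (semigroupRing K H) (LaurentSeries K) r).coeff 0 =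
      PowerSeries.constantCoeff (r : PowerSeries K) := by
    change (HahnSeries.ofPowerSeries ℤ K (r : PowerSeries K)).coeff 0 = _
    rw [PowerSeries.coeff_coe]
    simp
  rw [mem_maximalIdeal, mem_nonunits_iff, h0, not_iff_comm]
  constructor
  · intro h
    exact IsUnit.of_mul_eq_one ⟨(r : PowerSeries K)⁻¹, inv_mem_semigroupRing r.2⟩
      (Subtype.ext (PowerSeries.mul_inv_cancel _ h))
  · intro h
    exact ((h.map (semigroupRing K H).val).map (PowerSeries.constantCoeff (R := K))).ne_zero

theorem mem_orderGE_one_of_mem_maximalIdeal {r : semigroupRing K H}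
    (hr : r ∈ maximalIdeal (semigroupRing K H)) :
    algebraMap (semigroupRing K H) (LaurentSeries K) r ∈ orderGE K H 1 := by
  intro i hi
  rcases (show i ≤ 0 by omega).lt_or_eq with h | rfl
  · exact algebraMap_mem_orderGE r i h
  · exact (mem_maximalIdeal_iff_coeff r).1 hr

theorem monomial_mem_maximalIdeal {h : H} (h0 : (h : ℕ) ≠ 0) :
    semigroupRing.monomial K h ∈ maximalIdeal (semigroupRing K H) := by
  rw [mem_maximalIdeal_iff_coeff, algebraMap_monomial, HahnSeries.coeff_single, if_neg]
  exact_mod_cast h0.symm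

theorem monomial_smul (h : H) (x : LaurentSeries K) :
    semigroupRing.monomial K h • x = HahnSeries.single ((h : ℕ) : ℤ) 1 * x := by
  rw [Algebra.smul_def, algebraMap_monomial]

theorem single_neg_mul_single_mul (n : ℤ) (x : LaurentSeries K) :
    HahnSeries.single n (1 : K) * (HahnSeries.single (-n) 1 * x) = x := by
  rw [← mul_assoc, HahnSeries.single_mul_single, add_neg_cancel, one_mul]
  exact one_mul x

theorem single_eq_smul_single_one (n : ℤ) (c : K) :
    HahnSeries.single n c = c • HahnSeries.single n (1 : K) := by
  ext i
  rw [HahnSeries.coeff_smul, HahnSeries.coeff_single, HahnSeries.coeff_single]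
  split_ifs <;> simp

/-- Truncation: reduces questions modulo high order to finitely many monomials. -/
theorem sub_sum_single_mem_orderGE {m n : ℤ} {x : LaurentSeries K} (hx : x ∈ orderGE K H m) :
    x - ∑ i ∈ Finset.Ico m n, HahnSeries.single i (x.coeff i) ∈ orderGE K H n := by
  intro i hi
  rw [HahnSeries.coeff_sub, HahnSeries.coeff_sum]
  by_cases h : i ∈ Finset.Ico m n
  · rw [Finset.sum_eq_single_of_mem i h, HahnSeries.coeff_single_same, sub_self]
    exact fun j _ hj => HahnSeries.coeff_single_of_ne hj.symm
  · rw [Finset.mem_Ico] at h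
    rw [hx i (by omega), Finset.sum_eq_zero, sub_zero]
    intro j hj
    rw [HahnSeries.coeff_single]
    split_ifs with hij
    · rw [← hij, hx i (by omega)]
    · rfl

/-! ### Fraction field, integral closure, dimension and Noetherianity -/

section Frobenius

variable {F : ℕ} (hF : ∀ n, F < n → n ∈ H)

include hF in
theorem exists_algebraMap_eq_of_mem_orderGE {x : LaurentSeries K}
    (hx : x ∈ orderGE K H (F + 1)) :
    ∃ r : semigroupRing K H, algebraMap (semigroupRing K H) (LaurentSeries K) r = x := by
  refine exists_algebraMap_eq fun n hn => ?_
  have : ¬ n < F + 1 := fun h => hn (hx n h)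
  exact ⟨n.toNat, hF _ (by omega), by omega⟩

include hF in
theorem isFractionRing_laurentSeries :
    IsFractionRing (semigroupRing K H) (LaurentSeries K) := by
  refine IsFractionRing.of_field _ _ fun z => ?_
  obtain ⟨n, hn⟩ := exists_mem_orderGE (H := H) z
  -- This exponent exceeds `F`, so lies in `H`, and it raises order `n` to at least `F + 1`.
  let h : H := ⟨n.natAbs + F + 1, hF _ (by omega)⟩
  have hz : semigroupRing.monomial K h • z ∈ orderGE K H (F + 1) := by
    rw [monomial_smul]
    refine orderGE_anti ?_ (mul_mem_orderGE (single_mem_orderGE le_rfl _) hn)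
    change (F + 1 : ℤ) ≤ ((n.natAbs + F + 1 : ℕ) : ℤ) + n
    omega
  obtain ⟨r, hr⟩ := exists_algebraMap_eq_of_mem_orderGE hF hz
  refine ⟨r, semigroupRing.monomial K h, ?_⟩
  have h0 : algebraMap (semigroupRing K H) (LaurentSeries K) (semigroupRing.monomial K h) ≠ 0 := by
    rw [algebraMap_monomial]
    exact HahnSeries.single_ne_zero one_ne_zero
  rw [hr, Algebra.smul_def, mul_div_cancel_left₀ _ h0]

include hF in
-- The monomials of exponents 0 to `F` generate: what remains has order above `F` and is an element
-- of `K[[H]]` times 1.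
theorem orderGE_zero_fg : (orderGE K H 0).FG := by
  classical
  refine ⟨(Finset.Ico (0 : ℤ) (F + 1)).image fun i => HahnSeries.single i (1 : K), ?_⟩
  apply le_antisymm
  · rw [Submodule.span_le]
    intro x hx
    obtain ⟨i, hi, rfl⟩ := Finset.mem_image.1 hx
    exact single_mem_orderGE (Finset.mem_Ico.1 hi).1 _
  · intro x hx
    have hmem : ∀ i ∈ Finset.Ico (0 : ℤ) (F + 1), HahnSeries.single i (1 : K) ∈
        Submodule.span (semigroupRing K H)
          (((Finset.Ico (0 : ℤ) (F + 1)).image fun i => HahnSeries.single i (1 : K) :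
            Finset (LaurentSeries K)) : Set (LaurentSeries K)) := fun i hi =>
      Submodule.subset_span (Finset.mem_coe.2 (Finset.mem_image_of_mem _ hi))
    obtain ⟨r, hr⟩ := exists_algebraMap_eq_of_mem_orderGE hF
      (sub_sum_single_mem_orderGE (n := F + 1) hx)
    rw [← sub_add_cancel x (∑ i ∈ Finset.Ico (0 : ℤ) (F + 1), HahnSeries.single i (x.coeff i)),
      ← hr]
    refine add_mem ?_ (sum_mem fun i hi => ?_)
    · rw [Algebra.algebraMap_eq_smul_one]
      exact Submodule.smul_mem _ _ (hmem 0 (by simp))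
    · have : HahnSeries.single i (x.coeff i) = x.coeff i • HahnSeries.single i (1 : K) := by
        rw [← single_eq_smul_single_one]
      rw [this]
      exact Submodule.smul_of_tower_mem _ _ (hmem i hi)

include hF in
-- `K[[t]]` is integrally closed, which bounds the closure; conversely a series of nonnegative order
-- stabilizes the finitely generated module `K[[t]]`.
theorem integralClosure_laurentSeries :
    Subalgebra.toSubmodule (integralClosure (semigroupRing K H) (LaurentSeries K)) =
      orderGE K H 0 := by
  ext x
  rw [Subalgebra.mem_toSubmodule, mem_integralClosure_iff]
  constructor
  · intro hx
    obtain ⟨y, rfl⟩ := IsIntegrallyClosed.isIntegral_iff.1 (hx.tower_top (A := PowerSeries K))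
    intro i hi
    change (HahnSeries.ofPowerSeries ℤ K y).coeff i = 0
    rw [PowerSeries.coeff_coe, if_pos hi]
  · intro hx
    have h1 : (HahnSeries.single 0 1 : LaurentSeries K) ∈ orderGE K H 0 :=
      single_mem_orderGE le_rfl 1
    refine isIntegral_of_smul_mem_submodule (orderGE K H 0) ?_ (orderGE_zero_fg hF) x
      fun n hn => by simpa using mul_mem_orderGE hx hn
    rintro h
    rw [h, Submodule.mem_bot] at h1
    exact one_ne_zero h1

include hF in
-- A high power of `r`, divided by `a`, still has order above `F`, so the quotient is in `K[[H]]`.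
-- Hence every nonzero prime is maximal.
theorem maximalIdeal_le_radical_span {a : semigroupRing K H} (ha : a ≠ 0) :
    maximalIdeal (semigroupRing K H) ≤ (Ideal.span {a}).radical := by
  intro r hr
  obtain ⟨n, hn⟩ := exists_orderGE_mul_inv (H := H)
    (algebraMap (semigroupRing K H) (LaurentSeries K) a)
  obtain ⟨s, hs⟩ := exists_algebraMap_eq_of_mem_orderGE hF (hn (F + 1)
    (algebraMap (semigroupRing K H) (LaurentSeries K) r ^ (n.natAbs + F + 1))
    (orderGE_anti (by have := Int.le_natAbs (a := n); omega)
      (pow_mem_orderGE (mem_orderGE_one_of_mem_maximalIdeal hr) (n.natAbs + F + 1))))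
  refine ⟨n.natAbs + F + 1, Ideal.mem_span_singleton'.2 ⟨s, ?_⟩⟩
  have hinj := FaithfulSMul.algebraMap_injective (semigroupRing K H) (LaurentSeries K)
  have ha' : algebraMap (semigroupRing K H) (LaurentSeries K) a ≠ 0 := by
    rwa [Ne, map_eq_zero_iff _ hinj]
  apply hinj
  rw [map_mul, hs, map_pow, mul_comm, mul_inv_cancel_left₀ ha']

include hF in
theorem exists_monomial_mem_maximalIdeal :
    ∃ x ∈ maximalIdeal (semigroupRing K H), x ≠ 0 := by
  refine ⟨semigroupRing.monomial K ⟨F + 1, hF _ (by omega)⟩,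
    monomial_mem_maximalIdeal (by simp), fun h => ?_⟩
  have := congrArg (algebraMap (semigroupRing K H) (LaurentSeries K)) h
  rw [algebraMap_monomial, map_zero] at this
  exact HahnSeries.single_ne_zero one_ne_zero this

include hF in
theorem ringKrullDim_semigroupRing : ringKrullDim (semigroupRing K H) = 1 := by
  rw [ringKrullDim_eq_one_iff_of_isLocalRing_isDomain]
  refine ⟨fun h => ?_, fun x hx => maximalIdeal_le_radical_span hF hx⟩
  obtain ⟨x, hx, hx0⟩ := exists_monomial_mem_maximalIdeal (K := K) hF
  obtain ⟨y, hy⟩ := h.mul_inv_cancel hx0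
  exact (mem_nonunits_iff.1 ((mem_maximalIdeal x).1 hx)) (IsUnit.of_mul_eq_one y hy)

include hF in
-- Monomials with positive exponents up to `2 * F + 1` suffice: a series of order at least `2 * F +
-- 2` is t^(F+1) times one of order at least `F + 1`, which is in `K[[H]]`.
theorem maximalIdeal_semigroupRing_fg : (maximalIdeal (semigroupRing K H)).FG := by
  classical
  let S : Finset H := ((Finset.Ico 1 (2 * F + 2)).subtype (· ∈ H))
  let h1 : H := ⟨F + 1, hF _ (by omega)⟩
  have hinj := FaithfulSMul.algebraMap_injective (semigroupRing K H) (LaurentSeries K)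
  refine ⟨S.image (semigroupRing.monomial K), ?_⟩
  have hS : ∀ {h : H}, h ∈ S ↔ 1 ≤ (h : ℕ) ∧ (h : ℕ) < 2 * F + 2 := by
    intro h
    simp [S]
  have hmem : ∀ h ∈ S, semigroupRing.monomial K h ∈
      Ideal.span ((S.image (semigroupRing.monomial K) : Finset _) :
        Set (semigroupRing K H)) := fun h hh =>
    Ideal.subset_span (Finset.mem_coe.2 (Finset.mem_image_of_mem _ hh))
  apply le_antisymm
  · refine Ideal.span_le.2 fun x hx => ?_
    obtain ⟨h, hh, rfl⟩ := Finset.mem_image.1 hx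
    exact monomial_mem_maximalIdeal (by have := hS.1 hh; omega)
  · intro r hr
    set x := algebraMap (semigroupRing K H) (LaurentSeries K) r with hx
    let s : semigroupRing K H := ∑ h ∈ S, x.coeff (h : ℕ) • semigroupRing.monomial K h
    have hs : algebraMap (semigroupRing K H) (LaurentSeries K) s =
        ∑ h ∈ S, HahnSeries.single ((h : ℕ) : ℤ) (x.coeff (h : ℕ)) := by
      rw [map_sum]
      refine Finset.sum_congr rfl fun h _ => ?_
      rw [Algebra.algebraMap_eq_smul_one, smul_assoc, ← Algebra.algebraMap_eq_smul_one,
        algebraMap_monomial, ← single_eq_smul_single_one]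
    have hxs : x - algebraMap (semigroupRing K H) (LaurentSeries K) s ∈
        orderGE K H (2 * F + 2) := by
      intro i hi
      rw [hs, HahnSeries.coeff_sub, HahnSeries.coeff_sum]
      simp only [HahnSeries.coeff_single]
      by_cases hxi : x.coeff i = 0
      · rw [hxi, Finset.sum_eq_zero, sub_zero]
        intro h _
        split_ifs with h'
        · rw [← h', hxi]
        · rfl
      · obtain ⟨m, hm, rfl⟩ := exists_mem_of_coeff_algebraMap_ne_zero r hxi
        have hm0 : m ≠ 0 := by
          rintro rfl
          exact hxi ((mem_maximalIdeal_iff_coeff r).1 hr)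
        rw [Finset.sum_eq_single ⟨m, hm⟩, if_pos rfl, sub_self]
        · intro b _ hb
          rw [if_neg]
          intro h
          exact hb (Subtype.ext (Nat.cast_injective (R := ℤ) h.symm))
        · intro h
          exact absurd (hS.2 ⟨by change 1 ≤ m; omega, by change m < _; omega⟩) h
    obtain ⟨q, hq⟩ := exists_algebraMap_eq_of_mem_orderGE hF
      (x := HahnSeries.single (-(F + 1 : ℤ)) 1 *
        (x - algebraMap (semigroupRing K H) (LaurentSeries K) s))
      (orderGE_anti (by omega) (mul_mem_orderGE (single_mem_orderGE le_rfl 1) hxs))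
    have hr' : r = s + semigroupRing.monomial K h1 * q := by
      apply hinj
      rw [map_add, map_mul, hq, algebraMap_monomial]
      have : (((h1 : ℕ) : ℤ)) = (F + 1 : ℤ) := by simp [h1]
      rw [this, single_neg_mul_single_mul, add_sub_cancel]
    rw [hr']
    refine add_mem (sum_mem fun h hh => Submodule.smul_of_tower_mem _ _ (hmem h hh)) ?_
    exact Ideal.mul_mem_right _ _ (hmem h1 (hS.2 ⟨by simp [h1], by simp [h1]; omega⟩))

include hF in
-- By Cohen's theorem only primes need be finitely generated, and these are 0 and the maximal ideal.
theorem isNoetherianRing_semigroupRing : IsNoetherianRing (semigroupRing K H) := by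
  refine IsNoetherianRing.of_prime fun p hp => ?_
  by_cases h : p = ⊥
  · rw [h]
    exact Submodule.fg_bot
  · obtain ⟨a, ha, ha0⟩ := Submodule.exists_mem_ne_zero_of_ne_bot h
    have : p = maximalIdeal (semigroupRing K H) := by
      refine le_antisymm (le_maximalIdeal hp.ne_top)
        ((maximalIdeal_le_radical_span hF ha0).trans ?_)
      rw [hp.radical_le_iff, Ideal.span_singleton_le_iff_mem]
      exact ha
    rw [this]
    exact maximalIdeal_semigroupRing_fg hF

end Frobenius

end SemigroupRing

/-! ### The canonical module: duality, existence and uniqueness -/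

section CanonicalModule

open IsLocalRing

variable {K : Type u} [Field K] {H : AddSubmonoid ℕ}

variable (K H) in
/-- The Laurent series `x` such that no series of `K[[H]] x` has exponent `F`. For `F` the Frobenius
number of `H`, it is the standard canonical module of `K[[H]]`. -/
def canonicalSubmodule (F : ℕ) : Submodule (semigroupRing K H) (LaurentSeries K) where
  carrier := {x | ∀ r : semigroupRing K H, (r • x).coeff (F : ℤ) = 0}
  add_mem' := by
    intro x y hx hy r
    rw [smul_add, HahnSeries.coeff_add, hx r, hy r, add_zero]
  zero_mem' := by
    intro r
    rw [smul_zero, HahnSeries.coeff_zero]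
  smul_mem' := by
    intro s x hx r
    rw [smul_smul]
    exact hx _

variable {F : ℕ}

/-- Monomials suffice as tests, so membership means that all exponents lie in Ω. -/
theorem mem_canonicalSubmodule_iff {x : LaurentSeries K} :
    x ∈ canonicalSubmodule K H F ↔ ∀ h ∈ H, x.coeff ((F : ℤ) - (h : ℕ)) = 0 := by
  constructor
  · intro hx h hh
    have := hx (semigroupRing.monomial K ⟨h, hh⟩)
    rwa [monomial_smul, HahnSeries.coeff_single_mul, one_mul] at this
  · intro hx r
    by_contra h
    rw [Algebra.smul_def] at h
    obtain ⟨i, j, hij, hi, hj⟩ := LaurentSeries.exists_coeff_ne_zero_of_coeff_mul_ne_zero h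
    obtain ⟨m, hm, rfl⟩ := exists_mem_of_coeff_algebraMap_ne_zero r hi
    refine hj ?_
    rw [← hx m hm]
    congr 1
    omega

theorem coeff_eq_zero_of_mem_canonicalSubmodule {x : LaurentSeries K}
    (hx : x ∈ canonicalSubmodule K H F) : x.coeff (F : ℤ) = 0 := by
  simpa using mem_canonicalSubmodule_iff.1 hx 0 H.zero_mem

theorem single_mem_canonicalSubmodule {n : ℤ} (hn : ∀ h ∈ H, (F : ℤ) - (h : ℕ) ≠ n) (c : K) :
    HahnSeries.single n c ∈ canonicalSubmodule K H F :=
  mem_canonicalSubmodule_iff.2 fun h hh => HahnSeries.coeff_single_of_ne (hn h hh)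

theorem orderGE_le_canonicalSubmodule : orderGE K H (F + 1) ≤ canonicalSubmodule K H F := by
  intro x hx
  rw [mem_canonicalSubmodule_iff]
  exact fun h _ => hx _ (by omega)

theorem one_le_canonicalSubmodule (hF0 : F ∉ H) : 1 ≤ canonicalSubmodule K H F := by
  rw [Submodule.one_le]
  refine single_mem_canonicalSubmodule (fun h hh h0 => hF0 ?_) 1
  have : h = F := by omega
  exact this ▸ hh

theorem canonicalSubmodule_le (hF : ∀ n, F < n → n ∈ H) :
    canonicalSubmodule K H F ≤ orderGE K H 0 := by
  intro x hx i hi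
  rw [← mem_canonicalSubmodule_iff.1 hx ((F : ℤ) - i).toNat (hF _ (by omega))]
  congr 1
  omega

/-- On series of order at least `m`, such a `ψ` sees finitely many coefficients; placing ψ(t^i) at
exponent `F - i` represents it by the pairing. -/
theorem exists_functional_eq_coeff_mul (F : ℕ) (ψ : LaurentSeries K →ₗ[K] K) (m n : ℤ)
    (hψ : ∀ x ∈ orderGE K H n, ψ x = 0) :
    ∃ y : LaurentSeries K, ∀ x ∈ orderGE K H m, ψ x = (x * y).coeff (F : ℤ) := by
  refine ⟨∑ i ∈ Finset.Ico m n, HahnSeries.single (F - i) (ψ (HahnSeries.single i 1)),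
    fun x hx => ?_⟩
  have h := hψ _ (sub_sum_single_mem_orderGE (n := n) hx)
  rw [map_sub, sub_eq_zero, map_sum] at h
  rw [h, Finset.mul_sum, HahnSeries.coeff_sum]
  refine Finset.sum_congr rfl fun i _ => ?_
  rw [HahnSeries.coeff_mul_single, sub_sub_cancel, single_eq_smul_single_one, map_smul,
    smul_eq_mul]

/-- Fractional ideals are reflexive with respect to the canonical module. -/
theorem canonicalSubmodule_div_div {X : Submodule (semigroupRing K H) (LaurentSeries K)} {m n : ℤ}
    (hm : X ≤ orderGE K H m) (hn : orderGE K H n ≤ X) :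
    canonicalSubmodule K H F / (canonicalSubmodule K H F / X) = X := by
  apply le_antisymm
  · intro q hq
    by_contra hqX
    -- Separate `q` from `X` by a `K`-functional. The series `y` representing it lies in C : X, yet
    -- `q * y` has a nonzero coefficient at `F`.
    obtain ⟨ψ, hψq, hψ⟩ := Submodule.exists_le_ker_of_notMem (p := X.restrictScalars K) hqX
    obtain ⟨l, hl⟩ := exists_mem_orderGE (H := H) q
    obtain ⟨y, hy⟩ := exists_functional_eq_coeff_mul (H := H) F ψ (min l m) n
      fun x hx => hψ (hn hx)
    have hyX : y ∈ canonicalSubmodule K H F / X := by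
      rw [Submodule.mem_div_iff_forall_mul_mem]
      intro x hx r
      rw [mul_comm, ← smul_mul_assoc,
        ← hy _ (orderGE_anti (min_le_right l m) (hm (X.smul_mem r hx)))]
      exact hψ (X.smul_mem r hx)
    have := coeff_eq_zero_of_mem_canonicalSubmodule
      (Submodule.mem_div_iff_forall_mul_mem.1 hq y hyX)
    rw [← hy _ (orderGE_anti (min_le_left l m) hl)] at this
    exact hψq this
  · intro x hx
    rw [Submodule.mem_div_iff_forall_mul_mem]
    intro y hy
    rw [mul_comm]
    exact Submodule.mem_div_iff_forall_mul_mem.1 hy x hx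

variable (K H F) in
/-- The coefficient at `F` as a functional on the quotient by the canonical module. -/
theorem exists_functional_quotient_canonicalSubmodule :
    ∃ ρ : (LaurentSeries K ⧸ canonicalSubmodule K H F) →ₗ[K] K,
      ∀ x : LaurentSeries K, ρ (Submodule.Quotient.mk x) = x.coeff (F : ℤ) := by
  let coeffF : LaurentSeries K →ₗ[K] K :=
    { toFun := fun x => x.coeff (F : ℤ)
      map_add' := fun _ _ => rfl
      map_smul' := fun _ _ => rfl }
  exact ⟨(Submodule.liftQ ((canonicalSubmodule K H F).restrictScalars K) coeffF
      fun x hx => coeff_eq_zero_of_mem_canonicalSubmodule hx) ∘ₗ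
      (Submodule.Quotient.restrictScalarsEquiv K (canonicalSubmodule K H F)).symm.toLinearMap,
    fun _ => rfl⟩

theorem exists_functional_extending_ideal (I : Ideal (semigroupRing K H)) (θ : I →ₗ[K] K) :
    ∃ ψ : LaurentSeries K →ₗ[K] K, ∀ (x : semigroupRing K H) (hx : x ∈ I),
      ψ (algebraMap (semigroupRing K H) (LaurentSeries K) x) = θ ⟨x, hx⟩ := by
  let ι : semigroupRing K H →ₗ[K] LaurentSeries K :=
    (Algebra.linearMap (semigroupRing K H) (LaurentSeries K)).restrictScalars K
  have hι : LinearMap.ker ι = ⊥ := LinearMap.ker_eq_bot_of_injective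
    (FaithfulSMul.algebraMap_injective (semigroupRing K H) (LaurentSeries K))
  obtain ⟨p, hp⟩ := LinearMap.exists_leftInverse_of_injective ι hι
  obtain ⟨θ', hθ'⟩ := LinearMap.exists_extend (p := I.restrictScalars K) θ
  refine ⟨θ' ∘ₗ p, fun x hx => ?_⟩
  have h1 : p (ι x) = x := LinearMap.congr_fun hp x
  have h2 : θ' x = θ ⟨x, hx⟩ := LinearMap.congr_fun hθ' ⟨x, hx⟩
  rw [← h2]
  exact congrArg θ' h1

variable (hF : ∀ n, F < n → n ∈ H)

include hF in
-- Baer's criterion by duality: compose `g` with the coefficient at `F`, extend it `K`-linearly to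
-- Laurent series, and represent it by a series `y`. The class of `y` then extends `g`.
theorem injective_quotient_canonicalSubmodule :
    Module.Injective (semigroupRing K H) (LaurentSeries K ⧸ canonicalSubmodule K H F) := by
  refine Module.Baer.injective fun I g => ?_
  by_cases hI : ∃ a ∈ I, a ≠ 0
  swap
  · push Not at hI
    refine ⟨0, fun x hx => ?_⟩
    have : (⟨x, hx⟩ : I) = 0 := Subtype.ext (hI x hx)
    rw [this, map_zero, LinearMap.zero_apply]
  obtain ⟨a, ha, ha0⟩ := hI
  have ha0' : algebraMap (semigroupRing K H) (LaurentSeries K) a ≠ 0 := by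
    rwa [Ne, map_eq_zero_iff _ (FaithfulSMul.algebraMap_injective _ _)]
  have hg : ∀ (r x : semigroupRing K H) (hx : x ∈ I),
      g ⟨r * x, I.mul_mem_left r hx⟩ = r • g ⟨x, hx⟩ := fun r x hx => g.map_smul r ⟨x, hx⟩
  obtain ⟨ρ, hρ⟩ := exists_functional_quotient_canonicalSubmodule K H F
  obtain ⟨ψ, hψ⟩ := exists_functional_extending_ideal I (ρ ∘ₗ g.restrictScalars K)
  replace hψ : ∀ (x : semigroupRing K H) (hx : x ∈ I),
      ψ (algebraMap (semigroupRing K H) (LaurentSeries K) x) = ρ (g ⟨x, hx⟩) := hψ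
  obtain ⟨l, hl⟩ := Submodule.Quotient.mk_surjective _ (g ⟨a, ha⟩)
  obtain ⟨m, hm⟩ := exists_mem_orderGE (H := H) l
  obtain ⟨n, hn⟩ := exists_orderGE_mul_inv (H := H)
    (algebraMap (semigroupRing K H) (LaurentSeries K) a)
  -- A series of such high order is `r * a` with `r` of order above `F + |m|`, so `r • l` has no
  -- coefficient at `F`.
  have hvan : ∀ x ∈ orderGE K H ((F + 1 + |m|) + n), ψ x = 0 := by
    intro x hx
    have hz := hn _ x hx
    obtain ⟨r, hr⟩ := exists_algebraMap_eq_of_mem_orderGE hF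
      (orderGE_anti (by have := abs_nonneg m; omega) hz)
    have hx' : x = algebraMap (semigroupRing K H) (LaurentSeries K) (r * a) := by
      rw [map_mul, hr, mul_comm, mul_inv_cancel_left₀ ha0']
    have hga : g ⟨r * a, I.mul_mem_left r ha⟩ = Submodule.Quotient.mk (r • l) := by
      rw [hg, Submodule.Quotient.mk_smul, hl]
    rw [hx', hψ _ (I.mul_mem_left r ha), hga, hρ, Algebra.smul_def, hr]
    exact mul_mem_orderGE hz hm _ (by have := neg_abs_le m; omega)
  obtain ⟨y, hy⟩ := exists_functional_eq_coeff_mul (H := H) F ψ 0 _ hvan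
  refine ⟨LinearMap.toSpanSingleton _ _ (Submodule.Quotient.mk y), fun x hx => ?_⟩
  obtain ⟨z, hz⟩ := Submodule.Quotient.mk_surjective _ (g ⟨x, hx⟩)
  rw [LinearMap.toSpanSingleton_apply, ← Submodule.Quotient.mk_smul, ← hz,
    Submodule.Quotient.eq]
  -- Membership in C is tested at `F` on all multiples, and `r * x` is again in `I`.
  intro r
  have hgx : g ⟨r * x, I.mul_mem_left r hx⟩ = Submodule.Quotient.mk (r • z) := by
    rw [hg, Submodule.Quotient.mk_smul, hz]
  have h := hψ (r * x) (I.mul_mem_left r hx)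
  rw [hgx, hρ, hy _ (algebraMap_mem_orderGE _), ← Algebra.smul_def] at h
  rw [smul_sub, HahnSeries.coeff_sub, sub_eq_zero, smul_smul, h]

include hF in
theorem residueField_linearMap_laurentSeries_eq_zero
    (f : ResidueField (semigroupRing K H) →ₗ[semigroupRing K H] LaurentSeries K) : f = 0 := by
  obtain ⟨x, hx, hx0⟩ := exists_monomial_mem_maximalIdeal (K := K) hF
  refine residueField_linearMap_eq_zero hx (fun y hy => ?_) f
  rw [Algebra.smul_def] at hy
  refine (mul_eq_zero.1 hy).resolve_left fun h => hx0 ?_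
  rwa [map_eq_zero_iff _ (FaithfulSMul.algebraMap_injective _ _)] at h

include hF in
theorem finite_of_le_orderGE_zero {X : Submodule (semigroupRing K H) (LaurentSeries K)}
    (hX : X ≤ orderGE K H 0) : X.FG := by
  have := isNoetherianRing_semigroupRing (K := K) hF
  have := isNoetherian_of_fg_of_noetherian _ (orderGE_zero_fg (K := K) hF)
  exact (isNoetherian_submodule.1 this) X hX

include hF in
theorem isCanonicalModule_canonicalSubmodule :
    IsCanonicalModule (semigroupRing K H) (canonicalSubmodule K H F) := by
  have := isFractionRing_laurentSeries (K := K) hF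
  have := injective_of_isFractionRing (R := semigroupRing K H) (LaurentSeries K)
  have := injective_quotient_canonicalSubmodule (K := K) hF
  have h0 := residueField_linearMap_laurentSeries_eq_zero (K := K) hF
  have hdim := ringKrullDim_semigroupRing (K := K) hF
  refine ⟨Module.Finite.iff_fg.2 (finite_of_le_orderGE_zero hF (canonicalSubmodule_le hF)), ?_, ?_⟩
  · intro i hi
    rw [hdim] at hi
    obtain rfl : i = 1 := by exact_mod_cast hi
    obtain ⟨e⟩ := nonempty_ext_one_equiv (R := semigroupRing K H)
      (ResidueField (semigroupRing K H)) (canonicalSubmodule K H F) h0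
    have hFC : HahnSeries.single (F : ℤ) (1 : K) ∉ canonicalSubmodule K H F := by
      intro h
      have := coeff_eq_zero_of_mem_canonicalSubmodule h
      rw [HahnSeries.coeff_single_same] at this
      exact one_ne_zero this
    have hsoc : ∀ r ∈ maximalIdeal (semigroupRing K H),
        r • HahnSeries.single (F : ℤ) (1 : K) ∈ canonicalSubmodule K H F := by
      intro r hr
      refine orderGE_le_canonicalSubmodule ?_
      rw [Algebra.smul_def, add_comm]
      exact mul_mem_orderGE (mem_orderGE_one_of_mem_maximalIdeal hr)
        (single_mem_orderGE le_rfl _)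
    obtain ⟨f⟩ := nonempty_residueField_equiv hFC hsoc fun z hz => by
      -- If 𝔪z ⊆ C, the coefficients of `z` at `F - h`, for nonzero `h ∈ H`, vanish; only the term
      -- at `F` obstructs `z ∈ C`.
      refine ⟨algebraMap K _ (z.coeff (F : ℤ)), mem_canonicalSubmodule_iff.2 fun h hh => ?_⟩
      rw [algebraMap_smul, ← single_eq_smul_single_one, HahnSeries.coeff_sub]
      by_cases h0 : h = 0
      · simp [h0]
      · rw [HahnSeries.coeff_single_of_ne (by omega), sub_zero]
        have := coeff_eq_zero_of_mem_canonicalSubmodule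
          (hz _ (monomial_mem_maximalIdeal (h := ⟨h, hh⟩) h0))
        rwa [monomial_smul, HahnSeries.coeff_single_mul, one_mul] at this
    exact ⟨e ≪≫ₗ f⟩
  · intro i hi
    rw [hdim] at hi
    match i, hi with
    | 0, _ =>
      refine subsingleton_ext_zero fun f => ?_
      have := h0 ((canonicalSubmodule K H F).subtype ∘ₗ f)
      exact LinearMap.ext fun x => Subtype.ext (LinearMap.congr_fun this x)
    | 1, hi => exact absurd rfl hi
    | n + 2, _ => exact subsingleton_ext_add_two _ _ n

include hF in
/-- A fractional ideal of type one is isomorphic to the standard canonical module. -/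
theorem nonempty_equiv_canonicalSubmodule
    {X : Submodule (semigroupRing K H) (LaurentSeries K)} (h1 : 1 ≤ X) (hX : X ≤ orderGE K H 0)
    (e : (ResidueField (semigroupRing K H) →ₗ[semigroupRing K H] LaurentSeries K ⧸ X)
      ≃ₗ[semigroupRing K H] ResidueField (semigroupRing K H)) :
    Nonempty (X ≃ₗ[semigroupRing K H] canonicalSubmodule K H F) := by
  set C := canonicalSubmodule K H F with hC
  set 𝔪 := maximalIdeal (semigroupRing K H) with h𝔪
  set D := C / X with hD
  have h1X : (1 : LaurentSeries K) ∈ X := Submodule.one_le.1 h1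
  have hXn : orderGE K H (F + 1) ≤ X := by
    intro x hx
    obtain ⟨r, rfl⟩ := exists_algebraMap_eq_of_mem_orderGE hF hx
    rw [Algebra.algebraMap_eq_smul_one]
    exact X.smul_mem r h1X
  have hD0 : D ≤ orderGE K H 0 := by
    intro y hy
    have := Submodule.mem_div_iff_forall_mul_mem.1 hy 1 h1X
    rw [mul_one] at this
    exact canonicalSubmodule_le hF this
  have hDn : orderGE K H (F + 1) ≤ D := by
    intro y hy
    rw [hD, Submodule.mem_div_iff_forall_mul_mem]
    intro x hx
    have := mul_mem_orderGE hy (hX hx)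
    rw [add_zero] at this
    exact orderGE_le_canonicalSubmodule this
  have h𝔪D : 𝔪 • D ≤ D := Submodule.smul_le_right
  -- Containing all series of high order makes the duality applicable to `𝔪 • D` and to modules
  -- between it and `D`.
  have h𝔪Dn : orderGE K H (2 * F + 2) ≤ 𝔪 • D := by
    intro y hy
    have hm := monomial_mem_maximalIdeal (K := K) (h := ⟨F + 1, hF _ (by omega)⟩)
      (Nat.succ_ne_zero F)
    have hy' : HahnSeries.single (-(F + 1 : ℤ)) 1 * y ∈ D :=
      hDn (orderGE_anti (by omega) (mul_mem_orderGE (single_mem_orderGE le_rfl 1) hy))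
    have := Submodule.smul_mem_smul hm hy'
    rw [monomial_smul] at this
    push_cast at this
    rwa [single_neg_mul_single_mul] at this
  have hDfg : D.FG := finite_of_le_orderGE_zero hF hD0
  have hjac : 𝔪 ≤ (⊥ : Ideal (semigroupRing K H)).jacobson :=
    (jacobson_eq_maximalIdeal _ bot_ne_top).ge
  have hCD : C / D = X := canonicalSubmodule_div_div hX hXn
  -- a minimal generator of `D`
  obtain ⟨d, hdD, hd⟩ : ∃ d ∈ D, d ∉ 𝔪 • D := by
    by_contra! h
    have hbot : D ≤ ⊥ := Submodule.le_of_le_smul_of_le_jacobson_bot hDfg hjac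
      (by rw [bot_sup_eq]; exact h)
    have := hbot (hDn (single_mem_orderGE (n := F + 1) le_rfl 1))
    exact HahnSeries.single_ne_zero one_ne_zero ((Submodule.mem_bot _).1 this)
  have hdspan : Submodule.span (semigroupRing K H) {d} ≤ D := by
    rwa [Submodule.span_singleton_le_iff_mem]
  set D₁ := Submodule.span (semigroupRing K H) {d} ⊔ 𝔪 • D with hD₁
  have hD₁D : D₁ ≤ D := sup_le hdspan h𝔪D
  -- Otherwise dualizing 𝔪D ⊊ D₁ ⊊ D gives X ⊊ C : D₁ ⊊ C : 𝔪D, all killed into `X` by 𝔪. This is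
  -- two proper steps in a socle of length one.
  have hD₁_eq : D₁ = D := by
    by_contra hne
    have hdd : ∀ {Y : Submodule (semigroupRing K H) (LaurentSeries K)}, Y ≤ D → 𝔪 • D ≤ Y →
        C / (C / Y) = Y := fun h h' =>
      canonicalSubmodule_div_div (h.trans hD0) (h𝔪Dn.trans h')
    have hanti : ∀ {Y Z : Submodule (semigroupRing K H) (LaurentSeries K)}, Y ≤ Z →
        C / Z ≤ C / Y := by
      intro Y Z hYZ x hx
      rw [Submodule.mem_div_iff_forall_mul_mem] at hx ⊢
      exact fun y hy => hx y (hYZ hy)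
    obtain ⟨y, hy, hyX⟩ : ∃ y ∈ C / D₁, y ∉ X := by
      by_contra! h
      have : C / D₁ = C / D := le_antisymm (by rw [hCD]; exact h) (hanti hD₁D)
      exact hne (by rw [← hdd hD₁D le_sup_right, this, hdd le_rfl h𝔪D])
    obtain ⟨z, hz, hzD₁⟩ : ∃ z ∈ C / (𝔪 • D), z ∉ C / D₁ := by
      by_contra! h
      have : C / (𝔪 • D) = C / D₁ := le_antisymm h (hanti le_sup_right)
      have h2 : 𝔪 • D = D₁ := by
        rw [← hdd h𝔪D le_rfl, this, hdd hD₁D le_sup_right]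
      rw [h2] at hd
      exact hd (Submodule.mem_sup_left (Submodule.mem_span_singleton_self d))
    have hsoc : ∀ w ∈ C / (𝔪 • D), ∀ r ∈ 𝔪, r • w ∈ X := by
      intro w hw r hr
      rw [← hCD, Submodule.mem_div_iff_forall_mul_mem]
      intro x hx
      rw [smul_mul_assoc, ← mul_smul_comm]
      exact Submodule.mem_div_iff_forall_mul_mem.1 hw _ (Submodule.smul_mem_smul hr hx)
    obtain ⟨r, hr⟩ := exists_sub_smul_mem_of_equiv e hyX
      (hsoc y (hanti le_sup_right hy)) (hsoc z hz)
    rw [← hCD] at hr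
    have := add_mem (hanti hD₁D hr) ((C / D₁).smul_mem r hy)
    rw [sub_add_cancel] at this
    exact hzD₁ this
  have hDd : D = Submodule.span (semigroupRing K H) {d} :=
    le_antisymm (Submodule.le_of_le_smul_of_le_jacobson_bot hDfg hjac hD₁_eq.ge) hdspan
  have hd0 : d ≠ 0 := by
    rintro rfl
    exact hd (zero_mem _)
  -- By Nakayama `D` is generated by `d`, so X = C : D is d⁻¹C.
  have hmem : ∀ x : LaurentSeries K, x ∈ X ↔ d * x ∈ C := by
    intro x
    rw [← hCD, Submodule.mem_div_iff_forall_mul_mem, hDd, mul_comm d x]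
    refine ⟨fun h => h d (Submodule.mem_span_singleton_self d), fun h y hy => ?_⟩
    obtain ⟨r, rfl⟩ := Submodule.mem_span_singleton.1 hy
    rw [mul_smul_comm]
    exact C.smul_mem r h
  let f : X →ₗ[semigroupRing K H] C :=
    (LinearMap.mulLeft (semigroupRing K H) d).restrict fun x hx => (hmem x).1 hx
  refine ⟨LinearEquiv.ofBijective f ⟨?_, ?_⟩⟩
  · intro x y hxy
    exact Subtype.ext (mul_left_cancel₀ hd0 (congrArg Subtype.val hxy))
  · intro c
    have : d * (d⁻¹ * c) = c := mul_inv_cancel_left₀ hd0 _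
    exact ⟨⟨d⁻¹ * c, (hmem _).2 (by rw [this]; exact c.2)⟩, Subtype.ext this⟩

end CanonicalModule

/-! ### The far-flung property as a condition on the semigroup -/

section FarFlung

open IsLocalRing

variable {K : Type u} [Field K] {H : AddSubmonoid ℕ} {F : ℕ} (hF : ∀ n, F < n → n ∈ H)

theorem exists_mem_of_mem_one {x : LaurentSeries K}
    (hx : x ∈ (1 : Submodule (semigroupRing K H) (LaurentSeries K))) {n : ℤ} (hn : x.coeff n ≠ 0) :
    ∃ m ∈ H, (m : ℤ) = n := by
  obtain ⟨r, rfl⟩ := Submodule.mem_one.1 hx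
  exact exists_mem_of_coeff_algebraMap_ne_zero r hn

include hF in
theorem canonicalSubmodule_mul_div_eq_iff (hF0 : F ∉ H) :
    canonicalSubmodule K H F * (1 / canonicalSubmodule K H F) = 1 / orderGE K H 0 ↔
      ∀ n : ℕ, ∃ i j : ℕ, i + j = n ∧ (∀ h ∈ H, h + i ≠ F) ∧ ∀ h ∈ H, h + j ≠ F := by
  have h1C : (1 : LaurentSeries K) ∈ canonicalSubmodule K H F :=
    Submodule.one_le.1 (one_le_canonicalSubmodule hF0)
  have hF0' : ∀ h ∈ H, h + 0 ≠ F := fun h hh h' => hF0 (by rwa [← h', add_zero])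
  constructor
  · intro heq n
    by_contra! hn
    have hnF : n ≤ F := by
      by_contra! h
      obtain ⟨m, -, hm⟩ := hn 0 n (zero_add n) hF0'
      omega
    -- If `i ∈ Ω`, then `n - i ∉ Ω`, which says exactly that `F - n + i ∈ H`.
    have hK : ∀ i : ℕ, (∀ h ∈ H, h + i ≠ F) → F - n + i ∈ H := by
      intro i hi
      by_contra hmem
      have hin : i ≤ n := by
        by_contra! h
        exact hmem (hF _ (by omega))
      obtain ⟨m, hm, hmF⟩ := hn i (n - i) (by omega) hi
      exact hmem (by rwa [show F - n + i = m by omega])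
    have hdiv : HahnSeries.single ((F - n : ℕ) : ℤ) (1 : K) ∈ 1 / canonicalSubmodule K H F := by
      rw [Submodule.mem_div_iff_forall_mul_mem]
      intro c hc
      refine Submodule.mem_one.2 (exists_algebraMap_eq fun e he => ?_)
      rw [HahnSeries.coeff_single_mul, one_mul] at he
      have he0 : ¬ e - (F - n : ℕ) < 0 := fun h => he (canonicalSubmodule_le hF hc _ h)
      refine ⟨F - n + (e - (F - n : ℕ)).toNat, hK _ fun h hh hhe => he ?_, by omega⟩
      rw [← mem_canonicalSubmodule_iff.1 hc h hh]
      congr 1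
      omega
    have hmul := Submodule.mul_mem_mul h1C hdiv
    rw [heq, one_mul, Submodule.mem_div_iff_forall_mul_mem] at hmul
    -- In the conductor, t^(F-n) would multiply t^n to t^F inside `K[[H]]`.
    have h1 := hmul _ (single_mem_orderGE (n := (n : ℤ)) (by omega) 1)
    obtain ⟨m, hm, hmF⟩ := exists_mem_of_mem_one h1 (n := (F : ℤ)) (by
      rw [HahnSeries.coeff_single_mul, one_mul,
        show (F : ℤ) - (F - n : ℕ) = n by omega, HahnSeries.coeff_single_same]
      exact one_ne_zero)
    obtain rfl : m = F := by omega
    exact hF0 hm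
  · intro h
    apply le_antisymm
    · rw [Submodule.mul_le]
      intro c hc d hd
      rw [Submodule.mem_div_iff_forall_mul_mem] at hd ⊢
      have hdF : d ∈ orderGE K H (F + 1) := by
        intro i hi
        by_contra hdi
        have hd1 := hd 1 h1C
        rw [mul_one] at hd1
        obtain ⟨m, hm, rfl⟩ := exists_mem_of_mem_one hd1 hdi
        -- Multiplying `d` by t^k ∈ C turns its exponent `m` into `m + k = F - k'`, which is not in
        -- `H`.
        obtain ⟨k, k', hkk, hk, hk'⟩ := h (F - m)
        have hdk := hd (HahnSeries.single (k : ℤ) 1)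
          (single_mem_canonicalSubmodule (fun x hx hxk => hk x hx (by omega)) 1)
        obtain ⟨p, hp, hpk⟩ := exists_mem_of_mem_one hdk (n := (m : ℤ) + k) (by
          rwa [HahnSeries.coeff_mul_single, add_sub_cancel_right, mul_one])
        exact hk' p hp (by omega)
      intro y hy
      have := mul_mem_orderGE (mul_mem_orderGE (canonicalSubmodule_le hF hc) hdF) hy
      rw [zero_add, add_zero] at this
      exact Submodule.mem_one.2 (exists_algebraMap_eq_of_mem_orderGE hF this)
    · intro x hx
      rw [← one_mul x]
      refine Submodule.mul_mem_mul h1C ?_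
      rw [Submodule.mem_div_iff_forall_mul_mem] at hx ⊢
      exact fun y hy => hx y (canonicalSubmodule_le hF hy)

set_option synthInstance.maxHeartbeats 100000 in
include hF in
/-- `K[[H]]` is far-flung Gorenstein if and only if every natural number is a sum of two elements
of the standard canonical ideal of the numerical semigroup `H`. -/
theorem isFarFlungGorenstein_semigroupRing_iff (hF0 : F ∉ H) :
    IsFarFlungGorenstein (semigroupRing K H) ↔
      ∀ n : ℕ, ∃ i j : ℕ, i + j = n ∧ (∀ h ∈ H, h + i ≠ F) ∧ ∀ h ∈ H, h + j ≠ F := by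
  have := isFractionRing_laurentSeries (K := K) hF
  have hdim := ringKrullDim_semigroupRing (K := K) hF
  have hone := one_le_canonicalSubmodule (K := K) hF0
  rw [isFarFlungGorenstein_iff_of_isFractionRing (LaurentSeries K),
    integralClosure_laurentSeries hF, ← canonicalSubmodule_mul_div_eq_iff (K := K) hF hF0,
    ← map_traceIdeal_eq_mul_div _ hone]
  constructor
  · rintro ⟨-, -, -, -, C, h1, hC, hcan, htr⟩
    have := injective_of_isFractionRing (R := semigroupRing K H) (LaurentSeries K)
    obtain ⟨e⟩ := nonempty_ext_one_equiv (R := semigroupRing K H)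
      (ResidueField (semigroupRing K H)) C
      (residueField_linearMap_laurentSeries_eq_zero (K := K) hF)
    obtain ⟨f⟩ := hcan.ext_dim 1 (by rw [hdim, Nat.cast_one])
    -- Ext¹ shows that `C` has type one, so it is isomorphic to the standard module and has the same
    -- trace.
    obtain ⟨g⟩ := nonempty_equiv_canonicalSubmodule hF h1 hC (e.symm ≪≫ₗ f)
    rw [← traceIdeal_congr g, htr]
  · intro htr
    obtain ⟨x, hx, hx0⟩ := exists_monomial_mem_maximalIdeal (K := K) hF
    exact ⟨isNoetherianRing_semigroupRing hF, hdim, ⟨x, hx, mem_nonZeroDivisors_of_ne_zero hx0⟩,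
      Module.Finite.iff_fg.2 (orderGE_zero_fg hF), canonicalSubmodule K H F, hone,
      canonicalSubmodule_le hF, isCanonicalModule_canonicalSubmodule hF, htr⟩

end FarFlung

theorem mainTheorem10 (K : Type*) [Field K] (H : AddSubmonoid ℕ) (hH : IsNumericalSemigroup H)
    (v : ℕ) (a : ℕ → ℕ) (ha : IsMinimallyGeneratedBy H v a)
    (hne : H ≠ ⊤) (hmult : v = a 1) :
    IsFarFlungGorenstein (semigroupRing K H) ↔
      Set.Icc (2 * a v - a 1 + 1) (2 * a v) ⊆
        {n | ∃ i ∈ Set.Icc 2 v, ∃ j ∈ Set.Icc 2 v, n = a i + a j} := by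
  have hv := ha.two_le hH hne hmult
  rw [isFarFlungGorenstein_semigroupRing_iff
      (fun _ hn => ha.mem_of_frobenius_lt hv hmult hn) (ha.frobenius_notMem hv hmult),
    ha.forall_exists_add_eq_iff hv hmult]
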